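/- Let $n\ge 1$, $p>1$, $q=\frac{p}{p-1}$, and let $U=\prod_{i=1}^n I_i\subset\mathbb R^n$, where each $I_i$ is a closed interval of one of the forms $(-\infty,b]$, $[a,\infty)$, $[a,b]$ with $a<b$, or $\mathbb R$. Let $w$ be a strictly positive probability density on $U$ (measurable, $\int_U w\,d\xi=1$). For $r\ge 1$, $\mathcal L^r(w)$ denotes the space of measurable $f:U\to\mathbb R$ with $\int_U|f|^r w\,d\xi<\infty$, up to equality almost everywhere; a function of the single variable $\xi_i$ is regarded as a function on $U$. Write $\xi_i^c$ for $\xi$ with the $i$-th coordinate removed, $w_i(\xi_i)=\int w(\xi)\,d\xi_i^c$ and $w_i^c(\xi_i^c)=\int w(\xi)\,d\xi_i$ for the marginals of $w$, all integrals being over the corresponding factors of $U$. Assume $$\frac{w_i\,w_i^c}{w}\in\mathcal L^p(w),\qquad 1\le i\le n.$$ Let $g\in\mathcal L^p(w)$ be such that its weighted marginals $g_i(\xi_i):=\int g(\xi)w(\xi)\,d\xi_i^c$ satisfy $g_i\in\mathcal L^p(w)$ for $1\le i\le n$. For functions $\Phi_1,\dots,\Phi_n$ of one variable put $\overline\Phi(\xi)=\frac1n\sum_{i=1}^n\Phi_i(\xi_i)$.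 Call $(\Phi_1,\dots,\Phi_n)$ a solution if $\Phi_i\in\mathcal L^1(w)$ for every $i$, the function $\operatorname{sign}(\overline\Phi)|\overline\Phi|^{\frac1{p-1}}$ is in $\mathcal L^p(w)$, $$\int \operatorname{sign}(\overline\Phi(\xi))\,|\overline\Phi(\xi)|^{\frac{1}{p-1}}\,w(\xi)\,d\xi_i^c=g_i(\xi_i)\quad\text{for almost every }\xi_i\in I_i,\ 1\le i\le n,$$ and $$\int\Phi_i(\xi_i)w_i(\xi_i)\,d\xi_i=0,\qquad 2\le i\le n.$$ (a) There is a solution $(\Phi_1,\dots,\Phi_n)$ such that $$\int_U|f(\xi)|^p w(\xi)\,d\xi\ \ge\ \int_U|\overline\Phi(\xi)|^{\frac{p}{p-1}}w(\xi)\,d\xi$$ for every $f\in\mathcal L^p(w)$ with the same weighted marginals $g_1,\dots,g_n$ as $g$; in particular for $f=g$. (b) Suppose in addition that $w$ has the Smirnov property: whenever $\Psi_i\in\mathcal L^1(w)$ are functions of the single variable $\xi_i$, $1\le i\le n$, and $\frac1n\sum_{i=1}^n\Psi_i(\xi_i)\in\mathcal L^q(w)$, then $\Psi_i\in\mathcal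 L^q(w)$ for every $i$. Then the solution is unique: any two solutions $\Phi,\Psi$ satisfy $\Phi_i=\Psi_i$ almost everywhere on $I_i$ for every $i$. For the solution $\Phi$ one has $$\int_U|g|^pw\,d\xi\ \ge\ \int_U|\overline\Phi|^{\frac p{p-1}}w\,d\xi ,$$ with equality if and only if $g=\operatorname{sign}(\overline\Phi)\,|\overline\Phi|^{\frac1{p-1}}$ almost everywhere on $U$. -/

import Mathlib

open MeasureTheory

noncomputable section

namespace WeightedMarginals

/-- The closed intervals allowed as factors of the domain: half-lines, compact intervals of
positive length, and the whole line. -/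
def IsAdmissibleInterval (s : Set ℝ) : Prop :=
  (∃ b, s = Set.Iic b) ∨ (∃ a, s = Set.Ici a) ∨ (∃ a b, a < b ∧ s = Set.Icc a b) ∨ s = Set.univ

/-- The box `U = ∏ i, I i` in `ℝⁿ`. The dimension is `n = d + 1`. -/
def box {n : ℕ} (I : Fin n → Set ℝ) : Set (Fin n → ℝ) := Set.univ.pi I

/-- `w` is a strictly positive probability density on the box. -/
structure IsPositiveDensity {n : ℕ} (I : Fin n → Set ℝ) (w : (Fin n → ℝ) → ℝ) : Prop where
  pos : ∀ ξ ∈ box I, 0 < w ξ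
  integrableOn : IntegrableOn w (box I)
  integral_eq_one : ∫ ξ in box I, w ξ = 1

/-- The measure `w(ξ) dξ` on the box. The weighted Lebesgue space `L^r(w)` consists of the
functions `f` with `MemLp f r (weightMeasure I w)`. -/
def weightMeasure {n : ℕ} (I : Fin n → Set ℝ) (w : (Fin n → ℝ) → ℝ) : Measure (Fin n → ℝ) :=
  (volume.restrict (box I)).withDensity (fun ξ => ENNReal.ofReal (w ξ))

variable {d : ℕ}

/-- Membership of `f` in `L^r(w)`, for a real exponent `r`. -/
def MemWeightedLp (r : ℝ) (I : Fin (d + 1) → Set ℝ) (w f : (Fin (d + 1) → ℝ) → ℝ) : Prop :=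
  MemLp f (ENNReal.ofReal r) (weightMeasure I w)

/-- The one-dimensional marginal `x ↦ ∫ F(ξ) dξ_i^c` at `ξ_i = x`: all coordinates but the `i`-th
are integrated out over their intervals. -/
def marginal (I : Fin (d + 1) → Set ℝ) (F : (Fin (d + 1) → ℝ) → ℝ) (i : Fin (d + 1)) (x : ℝ) : ℝ :=
  ∫ y in box (fun j => I (i.succAbove j)), F (i.insertNth (α := fun _ => ℝ) x y)

/-- The complementary marginal `ξ_i^c ↦ ∫ F(ξ) dξ_i`: the `i`-th coordinate is integrated out. -/
def coMarginal (I : Fin (d + 1) → Set ℝ) (F : (Fin (d + 1) → ℝ) → ℝ) (i : Fin (d + 1))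
    (y : Fin d → ℝ) : ℝ :=
  ∫ x in I i, F (i.insertNth (α := fun _ => ℝ) x y)

/-- The function `w_i w_i^c / w`. -/
def likelihoodRatio (I : Fin (d + 1) → Set ℝ) (w : (Fin (d + 1) → ℝ) → ℝ) (i : Fin (d + 1))
    (ξ : Fin (d + 1) → ℝ) : ℝ :=
  marginal I w i (ξ i) * coMarginal I w i (i.removeNth ξ) / w ξ

/-- The weighted one-dimensional marginal `g_i = ∫ g(ξ) w(ξ) dξ_i^c`. -/
def weightedMarginal (I : Fin (d + 1) → Set ℝ) (w g : (Fin (d + 1) → ℝ) → ℝ) (i : Fin (d + 1)) :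
    ℝ → ℝ :=
  marginal I (fun ξ => g ξ * w ξ) i

/-- The average `ξ ↦ (1/n) ∑ i, Φ_i(ξ_i)`, where `n = d + 1`. -/
def average (Φ : Fin (d + 1) → ℝ → ℝ) (ξ : Fin (d + 1) → ℝ) : ℝ :=
  (1 / ((d + 1 : ℕ) : ℝ)) * ∑ i, Φ i (ξ i)

/-- The function `sign(f) |f|^{1/(p-1)}`. -/
def signedPower (p : ℝ) (f : (Fin (d + 1) → ℝ) → ℝ) (ξ : Fin (d + 1) → ℝ) : ℝ :=
  Real.sign (f ξ) * |f ξ| ^ (1 / (p - 1))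

/-- The Smirnov property of `w` with exponent `q`: if an average of one-variable functions in
`L^1(w)` is in `L^q(w)`, then so is every summand. -/
def Smirnov (q : ℝ) (I : Fin (d + 1) → Set ℝ) (w : (Fin (d + 1) → ℝ) → ℝ) : Prop :=
  ∀ Ψ : Fin (d + 1) → ℝ → ℝ,
    (∀ i, MemWeightedLp 1 I w (fun ξ => Ψ i (ξ i))) →
    MemWeightedLp q I w (average Ψ) →
    ∀ i, MemWeightedLp q I w (fun ξ => Ψ i (ξ i))

/-- `Φ = (Φ_1, …, Φ_n)` solves the system of integral equations with marginals `γ`: every `Φ_i` is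
in `L^1(w)`, the function `h = sign(Φ̄) |Φ̄|^{1/(p-1)}` is in `L^p(w)` and has weighted marginals
`γ_i`, and all but the first `Φ_i` are centred with respect to `w_i`. -/
structure IsSolution (p : ℝ) (I : Fin (d + 1) → Set ℝ) (w : (Fin (d + 1) → ℝ) → ℝ)
    (γ Φ : Fin (d + 1) → ℝ → ℝ) : Prop where
  memLp_one : ∀ i, MemWeightedLp 1 I w (fun ξ => Φ i (ξ i))
  memLp : MemWeightedLp p I w (signedPower p (average Φ))
  marginal_eq : ∀ i, weightedMarginal I w (signedPower p (average Φ)) i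
    =ᵐ[volume.restrict (I i)] γ i
  centred : ∀ i, i ≠ 0 → ∫ x in I i, Φ i x * marginal I w i x = 0

end WeightedMarginals

end

/-!
Write `μ` for the probability measure `w dξ` on the box and `q = p / (p - 1)`.

*Existence.* Among the functions in `L^p(μ)` with the weighted marginals of `g` there is one, `f`, of
least norm: prescribing the marginals amounts to prescribing the integrals over the sets
`{ξ | ξ i ∈ s}`, and minimizing sequences are Cauchy because `L^p` is uniformly convex
(`abs_sub_rpow_le`, `exists_minimizer_of_setIntegral_eq`). The Euler equation of this problem
(`integral_mul_eq_zero_of_minimal`) says that `φ = |f|^{p-2} f ∈ L^q(μ)` annihilates every function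
in `L^p(μ)` with zero marginals. It remains to see that such a `φ` is a sum of functions of one
variable, and this is where `w_i w_i^c / w ∈ L^p(μ)` enters: by Hölder's inequality the function
`A_i φ (x) = ∫ φ(x, y) w_i^c(y) dy` is then well defined and in `L^1(μ)`, and
`φ = ∑ A_i φ(ξ_i) - (n - 1) ∫ φ dμ` (`eq_sum_independentAverage`). This identity is obvious for
sums of one-variable functions; for `φ` it follows by integrating over an arbitrary measurable set
`T`, since the adjoint operator maps the indicator function of `T` to a function in `L^p(μ)` with zero
marginals. No description of the dual of `L^p` and no closure argument is needed. Centring the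
summands gives the solution, and `f = sign(Φ̄) |Φ̄|^{1/(p-1)}` is minimal by construction.

*Uniqueness, bound and equality.* Under the Smirnov property the components of a solution are in
`L^q(μ)`, so `Φ̄` annihilates differences of functions in `L^p(μ)` with equal marginals
(`integral_average_mul_sub_eq_zero`). Strict monotonicity of `x ↦ sign(x) |x|^{1/(p-1)}` then shows
that the averages of two solutions agree; the components are recovered by Fubini's theorem and the
centring conditions. The bound for `g` and its case of equality come from integrating the strict
tangent inequality for `|·|^p` at `sign(Φ̄) |Φ̄|^{1/(p-1)}`.
-/

noncomputable section

namespace WeightedMarginals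

open Filter Topology

/-! ### Convexity of `|x|^p` -/

theorem strictConvexOn_abs_rpow {p : ℝ} (hp : 1 < p) :
    StrictConvexOn ℝ Set.univ (fun x : ℝ => |x| ^ p) := by
  refine ⟨convex_univ, fun x _ y _ hxy a b ha hb hab => ?_⟩
  have hp0 : 0 < p := by linarith
  simp only [smul_eq_mul]
  have h1 : |a * x + b * y| ≤ a * |x| + b * |y| := by
    calc |a * x + b * y| ≤ |a * x| + |b * y| := abs_add_le _ _
      _ = _ := by rw [abs_mul, abs_mul, abs_of_pos ha, abs_of_pos hb]
  by_cases h : |x| = |y|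
  · have hy : y = -x := by
      rcases abs_eq_abs.1 h with h | h
      · exact absurd h hxy
      · linarith
    subst hy
    have hx : x ≠ 0 := fun h0 => hxy (by simp [h0])
    have hx' : 0 < |x| := abs_pos.2 hx
    have h2 : |a * x + b * -x| < |x| := by
      have : a * x + b * -x = (a - b) * x := by ring
      rw [this, abs_mul]
      have : |a - b| < 1 := abs_lt.2 ⟨by linarith, by linarith⟩
      nlinarith
    calc |a * x + b * -x| ^ p < |x| ^ p := Real.rpow_lt_rpow (abs_nonneg _) h2 hp0
      _ = a * |x| ^ p + b * |-x| ^ p := by rw [abs_neg, ← add_mul, hab, one_mul]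
  · calc |a * x + b * y| ^ p ≤ (a * |x| + b * |y|) ^ p :=
        Real.rpow_le_rpow (abs_nonneg _) h1 hp0.le
      _ < a * |x| ^ p + b * |y| ^ p :=
        (strictConvexOn_rpow hp).2 (abs_nonneg x) (abs_nonneg y) h ha hb hab

theorem abs_midpoint_rpow_lt {p : ℝ} (hp : 1 < p) {a b : ℝ} (hab : a ≠ b) :
    |(a + b) / 2| ^ p < (|a| ^ p + |b| ^ p) / 2 := by
  have h := (strictConvexOn_abs_rpow hp).2 (Set.mem_univ a) (Set.mem_univ b) hab
    (by norm_num : (0:ℝ) < 1/2) (by norm_num : (0:ℝ) < 1/2) (by norm_num)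
  simp only [smul_eq_mul] at h
  rw [show (a + b) / 2 = 1 / 2 * a + 1 / 2 * b by ring]
  linarith

theorem abs_midpoint_rpow_le {p : ℝ} (hp : 1 < p) (a b : ℝ) :
    |(a + b) / 2| ^ p ≤ (|a| ^ p + |b| ^ p) / 2 := by
  rcases eq_or_ne a b with rfl | h
  · simp
  · exact (abs_midpoint_rpow_lt hp h).le

theorem continuous_abs_rpow {p : ℝ} (hp : 0 < p) : Continuous (fun x : ℝ => |x| ^ p) :=
  continuous_abs.rpow_const fun _ => Or.inr hp.le

theorem tangent_lt_abs_rpow {p : ℝ} (hp : 1 < p) {a b : ℝ} (hab : a ≠ b) :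
    |a| ^ p + p * (|a| ^ (p - 2) * a) * (b - a) < |b| ^ p := by
  have hd := hasDerivAt_abs_rpow a hp
  have hc := strictConvexOn_abs_rpow hp
  rcases lt_or_gt_of_ne hab with h | h
  · have := hc.lt_slope_of_hasDerivAt (Set.mem_univ a) (Set.mem_univ b) h hd
    rw [slope_def_field, lt_div_iff₀ (by linarith)] at this
    linarith
  · have := hc.slope_lt_of_hasDerivAt (Set.mem_univ b) (Set.mem_univ a) h hd
    rw [slope_def_field, div_lt_iff₀ (by linarith)] at this
    linarith

theorem tangent_le_abs_rpow {p : ℝ} (hp : 1 < p) (a b : ℝ) :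
    |a| ^ p + p * (|a| ^ (p - 2) * a) * (b - a) ≤ |b| ^ p := by
  rcases eq_or_ne a b with rfl | h
  · simp
  · exact (tangent_lt_abs_rpow hp h).le

/-- The pointwise form of the uniform convexity of `L^p`. By homogeneity it suffices to consider
`(a, b)` on the unit sphere, where the convexity defect on the right is bounded below on the compact
set on which the first term alone does not suffice. -/
theorem abs_sub_rpow_le {p : ℝ} (hp : 1 < p) {ε : ℝ} (hε : 0 < ε) :
    ∃ C : ℝ, 0 ≤ C ∧ ∀ a b : ℝ, |a - b| ^ p ≤
      ε * (|a| ^ p + |b| ^ p) + C * ((|a| ^ p + |b| ^ p) / 2 - |(a + b) / 2| ^ p) := by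
  have hp0 : 0 < p := by linarith
  have hcont := continuous_abs_rpow hp0
  have hc1 : Continuous fun x : ℝ × ℝ => |x.1| ^ p := hcont.comp continuous_fst
  have hc2 : Continuous fun x : ℝ × ℝ => |x.2| ^ p := hcont.comp continuous_snd
  have hc3 : Continuous fun x : ℝ × ℝ => |x.1 - x.2| ^ p :=
    hcont.comp (continuous_fst.sub continuous_snd)
  have hc4 : Continuous fun x : ℝ × ℝ => |(x.1 + x.2) / 2| ^ p :=
    hcont.comp ((continuous_fst.add continuous_snd).div_const 2)
  set D : ℝ × ℝ → ℝ := fun x => (|x.1| ^ p + |x.2| ^ p) / 2 - |(x.1 + x.2) / 2| ^ p with hD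
  have hDc : Continuous D := ((hc1.add hc2).div_const 2).sub hc4
  have hD0 : ∀ x, 0 ≤ D x := fun x => sub_nonneg.2 (abs_midpoint_rpow_le hp _ _)
  set K : Set (ℝ × ℝ) := Metric.sphere 0 1 ∩
    {x | ε * (|x.1| ^ p + |x.2| ^ p) ≤ |x.1 - x.2| ^ p} with hK
  have hKc : IsCompact K :=
    (isCompact_sphere 0 1).inter_right (isClosed_le (continuous_const.mul (hc1.add hc2)) hc3)
  have hsphere : ∀ x : ℝ × ℝ, ‖x‖ = 1 → 0 < |x.1| ^ p + |x.2| ^ p := by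
    intro x hx
    by_contra hcon
    have e1 : |x.1| ^ p = 0 := by
      have := Real.rpow_nonneg (abs_nonneg x.1) p; have := Real.rpow_nonneg (abs_nonneg x.2) p
      linarith
    have e2 : |x.2| ^ p = 0 := by
      have := Real.rpow_nonneg (abs_nonneg x.1) p; have := Real.rpow_nonneg (abs_nonneg x.2) p
      linarith
    rw [Real.rpow_eq_zero (abs_nonneg _) hp0.ne', abs_eq_zero] at e1 e2
    have : x = 0 := Prod.ext e1 e2
    simp [this] at hx
  have hDpos : ∀ x ∈ K, 0 < D x := by
    rintro x ⟨hx1, hx2⟩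
    have hx1 := hsphere x (by simpa using hx1)
    refine sub_pos.2 (abs_midpoint_rpow_lt hp fun h => ?_)
    simp only [Set.mem_ofPred_eq, h, sub_self, abs_zero, Real.zero_rpow hp0.ne'] at hx2
    rw [h] at hx1
    nlinarith
  obtain ⟨δ, hδ, hδD⟩ : ∃ δ > 0, ∀ x ∈ K, δ ≤ D x := by
    rcases K.eq_empty_or_nonempty with h | h
    · exact ⟨1, one_pos, by simp [h]⟩
    · obtain ⟨x, hx, hmin⟩ := hKc.exists_isMinOn h hDc.continuousOn
      exact ⟨D x, hDpos x hx, fun y hy => hmin hy⟩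
  refine ⟨2 ^ p / δ, by positivity, ?_⟩
  have main : ∀ x : ℝ × ℝ, ‖x‖ = 1 →
      |x.1 - x.2| ^ p ≤ ε * (|x.1| ^ p + |x.2| ^ p) + 2 ^ p / δ * D x := by
    intro x hx
    by_cases hxK : x ∈ K
    · have h1 : |x.1 - x.2| ^ p ≤ 2 ^ p := by
        refine Real.rpow_le_rpow (abs_nonneg _) ?_ hp0.le
        have h1 := norm_fst_le x
        have h2 := norm_snd_le x
        rw [hx, Real.norm_eq_abs] at h1 h2
        exact (abs_sub _ _).trans (by linarith)
      have h2 : (2:ℝ) ^ p ≤ 2 ^ p / δ * D x := by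
        rw [div_mul_eq_mul_div, le_div_iff₀ hδ]
        exact mul_le_mul_of_nonneg_left (hδD x hxK) (by positivity)
      have := hsphere x hx
      nlinarith
    · have h1 : |x.1 - x.2| ^ p < ε * (|x.1| ^ p + |x.2| ^ p) := by
        by_contra hcon
        exact hxK ⟨by simpa using hx, not_lt.1 hcon⟩
      have : 0 ≤ 2 ^ p / δ * D x := mul_nonneg (by positivity) (hD0 x)
      linarith
  intro a b
  rcases eq_or_ne ((a, b) : ℝ × ℝ) 0 with h0 | h0
  · obtain ⟨rfl, rfl⟩ : a = 0 ∧ b = 0 := by simpa [Prod.ext_iff] using h0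
    simp [Real.zero_rpow hp0.ne']
  · -- rescale to the unit sphere
    set r := ‖((a, b) : ℝ × ℝ)‖ with hr
    have hr0 : 0 < r := norm_pos_iff.2 h0
    have hm := main (r⁻¹ • (a, b)) (by
      rw [norm_smul, norm_inv, norm_norm, inv_mul_cancel₀ hr0.ne'])
    have hs : ∀ t : ℝ, |t| ^ p = r ^ p * |r⁻¹ * t| ^ p := by
      intro t
      rw [abs_mul, abs_of_pos (inv_pos.2 hr0), ← Real.mul_rpow hr0.le (by positivity),
        mul_inv_cancel_left₀ hr0.ne']
    simp only [hD, Prod.smul_mk, smul_eq_mul] at hm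
    rw [hs (a - b), hs a, hs b, hs ((a + b) / 2),
      show r⁻¹ * (a - b) = r⁻¹ * a - r⁻¹ * b by ring,
      show r⁻¹ * ((a + b) / 2) = (r⁻¹ * a + r⁻¹ * b) / 2 by ring]
    have := mul_le_mul_of_nonneg_left hm (Real.rpow_nonneg hr0.le p)
    linarith

/-! ### Minimization in `L^p` -/

section Lp
variable {α : Type*} {m : MeasurableSpace α} {μ : Measure α} {p : ℝ}

theorem integrable_abs_rpow (hp : 1 < p) {f : α → ℝ} (hf : MemLp f (ENNReal.ofReal p) μ) :
    Integrable (fun x => |f x| ^ p) μ := by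
  have h := hf.integrable_norm_rpow (by simp; linarith) (by simp)
  rwa [ENNReal.toReal_ofReal (by linarith)] at h

theorem eLpNorm_eq_integral_abs_rpow (hp : 1 < p) {f : α → ℝ}
    (hf : MemLp f (ENNReal.ofReal p) μ) :
    eLpNorm f (ENNReal.ofReal p) μ = ENNReal.ofReal ((∫ x, |f x| ^ p ∂μ) ^ p⁻¹) := by
  have h := hf.eLpNorm_eq_integral_rpow_norm (by simp; linarith) (by simp)
  rwa [ENNReal.toReal_ofReal (by linarith)] at h

/-- In `L^p` with `1 < p`, a closed affine subspace cut out by prescribing integrals over a family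
of sets contains an element of least norm. Uniform convexity makes minimizing sequences Cauchy. -/
theorem exists_minimizer_of_setIntegral_eq [IsProbabilityMeasure μ] (hp : 1 < p)
    (S : Set (Set α)) {g : α → ℝ} (hg : MemLp g (ENNReal.ofReal p) μ) :
    ∃ f : α → ℝ, MemLp f (ENNReal.ofReal p) μ ∧
      (∀ s ∈ S, ∫ x in s, f x ∂μ = ∫ x in s, g x ∂μ) ∧
      ∀ f' : α → ℝ, MemLp f' (ENNReal.ofReal p) μ →
        (∀ s ∈ S, ∫ x in s, f' x ∂μ = ∫ x in s, g x ∂μ) →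
        ∫ x, |f x| ^ p ∂μ ≤ ∫ x, |f' x| ^ p ∂μ := by
  have hp0 : 0 < p := by linarith
  have hp1 : (1 : ENNReal) ≤ ENNReal.ofReal p := by simpa using ENNReal.ofReal_le_ofReal hp.le
  have : Fact ((1 : ENNReal) ≤ ENNReal.ofReal p) := ⟨hp1⟩
  set A : Set (α → ℝ) := {f | MemLp f (ENNReal.ofReal p) μ ∧
    ∀ s ∈ S, ∫ x in s, f x ∂μ = ∫ x in s, g x ∂μ} with hA
  set N : (α → ℝ) → ℝ := fun f => ∫ x, |f x| ^ p ∂μ with hN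
  have hN0 : ∀ f, 0 ≤ N f := fun f => integral_nonneg fun x => by positivity
  have hAne : (N '' A).Nonempty := ⟨N g, g, ⟨hg, fun _ _ => rfl⟩, rfl⟩
  have hAbdd : BddBelow (N '' A) := ⟨0, by rintro _ ⟨f, _, rfl⟩; exact hN0 f⟩
  set M := sInf (N '' A) with hM
  have hMle : ∀ f ∈ A, M ≤ N f := fun f hf => csInf_le hAbdd ⟨f, hf, rfl⟩
  obtain ⟨u, -, hu, huA⟩ := exists_seq_tendsto_sInf hAne hAbdd
  choose F hFA hFu using huA
  rw [← hM] at hu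
  have hmid : ∀ j k, (fun x => (F j x + F k x) / 2) ∈ A := by
    intro j k
    refine ⟨?_, fun s hs => ?_⟩
    · have h : (fun x => (F j x + F k x) / 2) = fun x => 1 / 2 * (F j + F k) x := by
        funext x
        simp only [Pi.add_apply]
        ring
      rw [h]
      exact ((hFA j).1.add (hFA k).1).const_mul (1 / 2)
    · rw [integral_div, integral_add ((hFA j).1.integrable hp1).integrableOn
        ((hFA k).1.integrable hp1).integrableOn, (hFA j).2 s hs, (hFA k).2 s hs]
      ring
  have hdiff : ∀ ε > 0, ∃ C : ℝ, 0 ≤ C ∧ ∀ j k, N (F j - F k) ≤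
      ε * (u j + u k) + C * ((u j + u k) / 2 - M) := by
    intro ε hε
    obtain ⟨C, hC, hCab⟩ := abs_sub_rpow_le hp hε
    refine ⟨C, hC, fun j k => ?_⟩
    have ij := integrable_abs_rpow hp (hFA j).1
    have ik := integrable_abs_rpow hp (hFA k).1
    have im := integrable_abs_rpow hp (hmid j k).1
    have is : Integrable (fun x => |F j x| ^ p + |F k x| ^ p) μ := ij.add ik
    have id : Integrable (fun x => (|F j x| ^ p + |F k x| ^ p) / 2
        - |(F j x + F k x) / 2| ^ p) μ := (is.div_const 2).sub im
    calc N (F j - F k) ≤ ∫ x, (ε * (|F j x| ^ p + |F k x| ^ p) + C * ((|F j x| ^ p + |F k x| ^ p) / 2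
          - |(F j x + F k x) / 2| ^ p)) ∂μ := by
          refine integral_mono (integrable_abs_rpow hp ((hFA j).1.sub (hFA k).1)) ?_
            fun x => hCab _ _
          exact (is.const_mul ε).add (id.const_mul C)
      _ = ε * (u j + u k) + C * ((u j + u k) / 2 - N (fun x => (F j x + F k x) / 2)) := by
          rw [integral_add (is.const_mul ε) (id.const_mul C), integral_const_mul,
            integral_const_mul, integral_sub (is.div_const 2) im, integral_div,
            integral_add ij ik, ← hFu j, ← hFu k]
      _ ≤ _ := by
          have := hMle _ (hmid j k)
          gcongr
  have hM0 : 0 ≤ M := le_csInf hAne (by rintro _ ⟨f, _, rfl⟩; exact hN0 f)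
  set G : ℕ → Lp ℝ (ENNReal.ofReal p) μ := fun k => (hFA k).1.toLp (F k) with hG
  have hdist : ∀ j k, dist (G j) (G k) = N (F j - F k) ^ p⁻¹ := by
    intro j k
    rw [dist_eq_norm, hG, ← MemLp.toLp_sub, Lp.norm_toLp,
      eLpNorm_eq_integral_abs_rpow hp ((hFA j).1.sub (hFA k).1),
      ENNReal.toReal_ofReal (Real.rpow_nonneg (hN0 _) _)]
  have hcauchy : CauchySeq G := by
    refine Metric.cauchySeq_iff.2 fun η hη => ?_
    have hηp : 0 < η ^ p := Real.rpow_pos_of_pos hη p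
    obtain ⟨C, hC, hCj⟩ := hdiff (η ^ p / (4 * (M + 1))) (by positivity)
    have hev : ∀ᶠ k in atTop, u k < M + min 1 (η ^ p / (4 * (C + 1))) :=
      hu.eventually_lt_const (by simp; positivity)
    obtain ⟨k₀, hk₀⟩ := eventually_atTop.1 hev
    refine ⟨k₀, fun j hj k hk => ?_⟩
    have aj := hk₀ j hj
    have ak := hk₀ k hk
    have m1 := min_le_left 1 (η ^ p / (4 * (C + 1)))
    have m2 := min_le_right 1 (η ^ p / (4 * (C + 1)))
    have e1 : η ^ p / (4 * (M + 1)) * (u j + u k) < η ^ p / (4 * (M + 1)) * (2 * (M + 1)) :=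
      mul_lt_mul_of_pos_left (by linarith) (by positivity)
    have e2 : C * ((u j + u k) / 2 - M) ≤ (C + 1) * (η ^ p / (4 * (C + 1))) := by
      have hnn : 0 ≤ (u j + u k) / 2 - M := by
        have h1 := hMle _ (hFA j)
        have h2 := hMle _ (hFA k)
        rw [hFu] at h1 h2
        linarith
      exact mul_le_mul (by linarith) (by linarith) hnn (by linarith)
    have e3 : η ^ p / (4 * (M + 1)) * (2 * (M + 1)) = η ^ p / 2 := by field_simp; norm_num
    have e4 : (C + 1) * (η ^ p / (4 * (C + 1))) = η ^ p / 4 := by field_simp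
    have e5 : N (F j - F k) < η ^ p := by
      have := hCj j k
      linarith
    rw [hdist]
    calc N (F j - F k) ^ p⁻¹ < (η ^ p) ^ p⁻¹ :=
          Real.rpow_lt_rpow (hN0 _) e5 (inv_pos.2 hp0)
      _ = η := Real.rpow_rpow_inv hη.le hp0.ne'
  obtain ⟨f, hf⟩ := cauchySeq_tendsto_of_complete hcauchy
  have hfm : MemLp f (ENNReal.ofReal p) μ := Lp.memLp f
  have hnorm : Tendsto (fun k => ‖G k‖) atTop (𝓝 ‖f‖) := hf.norm
  have hNorm : ∀ h : α → ℝ, MemLp h (ENNReal.ofReal p) μ →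
      (eLpNorm h (ENNReal.ofReal p) μ).toReal ^ p = N h := by
    intro h hh
    rw [eLpNorm_eq_integral_abs_rpow hp hh, ENNReal.toReal_ofReal (Real.rpow_nonneg (hN0 _) _),
      Real.rpow_inv_rpow (hN0 _) hp0.ne']
  have hNf : N f = M := by
    have h1 : Tendsto (fun k => ‖G k‖ ^ p) atTop (𝓝 (‖f‖ ^ p)) :=
      hnorm.rpow_const (Or.inr hp0.le)
    have h2 : (fun k => ‖G k‖ ^ p) = u := by
      funext k
      rw [hG, Lp.norm_toLp, hNorm _ (hFA k).1, hFu]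
    rw [h2, Lp.norm_def, hNorm _ hfm] at h1
    exact tendsto_nhds_unique h1 hu
  refine ⟨f, hfm, fun s hs => ?_, fun f' h1 h2 => hNf.trans_le (hMle f' ⟨h1, h2⟩)⟩
  have hL1 : Tendsto (fun k => eLpNorm (F k - (f : α → ℝ)) 1 μ) atTop (𝓝 0) := by
    have h1 : Tendsto (fun k => eLpNorm (F k - (f : α → ℝ)) (ENNReal.ofReal p) μ) atTop (𝓝 0) := by
      have := (Lp.tendsto_Lp_iff_tendsto_eLpNorm' G f).1 hf
      refine this.congr fun k => eLpNorm_congr_ae ?_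
      exact (MemLp.coeFn_toLp (hFA k).1).sub (ae_eq_refl _)
    refine tendsto_of_tendsto_of_tendsto_of_le_of_le tendsto_const_nhds h1 (fun _ => zero_le)
      fun k => ?_
    exact eLpNorm_le_eLpNorm_of_exponent_le hp1 ((hFA k).1.sub hfm).1
  have ht := tendsto_setIntegral_of_L1' (f : α → ℝ) (hfm.1)
    (Eventually.of_forall fun k => (hFA k).1.integrable hp1) hL1 s
  refine tendsto_nhds_unique ht ?_
  rw [show (fun k => ∫ x in s, F k x ∂μ) = fun _ => ∫ x in s, g x ∂μ from
    funext fun k => (hFA k).2 s hs]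
  exact tendsto_const_nhds

theorem abs_rpow_sub_two_mul_self {p : ℝ} (hp : 1 < p) (x : ℝ) :
    |(|x| ^ (p - 2) * x)| = |x| ^ (p - 1) := by
  rcases eq_or_ne x 0 with rfl | hx
  · simp [Real.zero_rpow (by linarith : p - 1 ≠ 0)]
  · have hx' := abs_pos.2 hx
    rw [abs_mul, abs_of_nonneg (Real.rpow_nonneg (abs_nonneg x) _)]
    nth_rw 2 [← Real.rpow_one |x|]
    rw [← Real.rpow_add hx']
    congr 1; ring

/-- The Euler equation of the problem of minimizing `∫ |f + t h|^p` at `t = 0`. -/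
theorem integral_mul_eq_zero_of_minimal (hp : 1 < p) {f h : α → ℝ}
    (hf : MemLp f (ENNReal.ofReal p) μ) (hh : MemLp h (ENNReal.ofReal p) μ)
    (hmin : ∀ t : ℝ, ∫ x, |f x| ^ p ∂μ ≤ ∫ x, |f x + t * h x| ^ p ∂μ) :
    ∫ x, |f x| ^ (p - 2) * f x * h x ∂μ = 0 := by
  have hp0 : 0 < p := by linarith
  have hmem : ∀ t : ℝ, MemLp (fun x => f x + t * h x) (ENNReal.ofReal p) μ :=
    fun t => hf.add (hh.const_mul t)
  have hm2 : Measurable fun x : ℝ => |x| ^ (p - 2) * x := by fun_prop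
  have hkey := hasDerivAt_integral_of_dominated_loc_of_deriv_le (μ := μ) (x₀ := (0:ℝ))
    (F := fun t x => |f x + t * h x| ^ p)
    (F' := fun t x => p * |f x + t * h x| ^ (p - 2) * (f x + t * h x) * h x)
    (bound := fun x => p * (|f x| + |h x|) ^ p)
    (s := Metric.ball 0 1) (Metric.ball_mem_nhds 0 one_pos)
    (Eventually.of_forall fun t => (integrable_abs_rpow hp (hmem t)).1)
    (integrable_abs_rpow hp (hmem 0)) ?_ ?_ ?_ ?_
  · have hloc : IsLocalMin (fun t : ℝ => ∫ x, |f x + t * h x| ^ p ∂μ) 0 :=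
      Eventually.of_forall fun t => by simpa using hmin t
    have h0 := hloc.hasDerivAt_eq_zero hkey.2
    simp only [zero_mul, add_zero] at h0
    have : ∫ x, p * |f x| ^ (p - 2) * f x * h x ∂μ
        = p * ∫ x, |f x| ^ (p - 2) * f x * h x ∂μ := by
      rw [← integral_const_mul]
      congr 1; funext x; ring
    rw [this] at h0
    exact (mul_eq_zero.1 h0).resolve_left hp0.ne'
  · have : AEStronglyMeasurable (fun x => p * (|f x| ^ (p - 2) * f x) * h x) μ :=
      ((hm2.comp_aemeasurable hf.1.aemeasurable).const_mul p
        |>.mul hh.1.aemeasurable).aestronglyMeasurable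
    refine this.congr (Eventually.of_forall fun x => ?_)
    simp only [zero_mul, add_zero]
    ring
  · refine Eventually.of_forall fun x t ht => ?_
    have ht1 : |t| ≤ 1 := by
      have := Metric.mem_ball.1 ht
      rw [Real.dist_eq, sub_zero] at this
      exact this.le
    have hle : |f x + t * h x| ≤ |f x| + |h x| := by
      refine (abs_add_le _ _).trans ?_
      rw [abs_mul]
      nlinarith [abs_nonneg (h x)]
    rw [Real.norm_eq_abs, mul_assoc p, abs_mul, abs_mul, abs_of_pos hp0,
      abs_rpow_sub_two_mul_self hp, mul_assoc]
    refine mul_le_mul_of_nonneg_left ?_ hp0.le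
    have hs : 0 ≤ |f x| + |h x| := by positivity
    calc |f x + t * h x| ^ (p - 1) * |h x| ≤ (|f x| + |h x|) ^ (p - 1) * (|f x| + |h x|) := by
          refine mul_le_mul (Real.rpow_le_rpow (abs_nonneg _) hle (by linarith)) ?_
            (abs_nonneg _) (Real.rpow_nonneg hs _)
          linarith [abs_nonneg (f x)]
      _ = (|f x| + |h x|) ^ p := by
          rw [← Real.rpow_add_one' hs (by linarith)]; congr 1; ring
  · have := integrable_abs_rpow hp (hf.abs.add hh.abs)
    refine (this.const_mul p).congr (Eventually.of_forall fun x => ?_)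
    simp only [Pi.add_apply, Pi.abs_apply]
    rw [abs_of_nonneg (by positivity : 0 ≤ |f x| + |h x|)]
  · refine Eventually.of_forall fun x t _ => ?_
    have h1 : HasDerivAt (fun t : ℝ => f x + t * h x) (h x) t := by
      simpa using ((hasDerivAt_id t).mul_const (h x)).const_add (f x)
    exact (hasDerivAt_abs_rpow _ hp).comp t h1

end Lp

/-! ### Fubini's theorem on the box -/

section Box
variable {d : ℕ} (I : Fin (d + 1) → Set ℝ) (i : Fin (d + 1))

theorem measurePreserving_insertNth :
    MeasurePreserving (MeasurableEquiv.piFinSuccAbove (fun _ => ℝ) i).symm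
      ((volume.restrict (I i)).prod (volume.restrict (box fun j => I (i.succAbove j))))
      (volume.restrict (box I)) := by
  have h := measurePreserving_piFinSuccAbove (fun j => (volume : Measure ℝ).restrict (I j)) i
  rw [← Measure.restrict_pi_pi, ← Measure.restrict_pi_pi, ← volume_pi, ← volume_pi] at h
  exact h.symm

theorem integrable_box_iff {F : (Fin (d + 1) → ℝ) → ℝ} :
    Integrable F (volume.restrict (box I)) ↔
      Integrable (fun z : ℝ × (Fin d → ℝ) => F (i.insertNth (α := fun _ => ℝ) z.1 z.2))
        ((volume.restrict (I i)).prod (volume.restrict (box fun j => I (i.succAbove j)))) :=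
  ((measurePreserving_insertNth I i).integrable_comp_emb
    (MeasurableEquiv.measurableEmbedding _)).symm

theorem aestronglyMeasurable_box_iff {F : (Fin (d + 1) → ℝ) → ℝ} :
    AEStronglyMeasurable F (volume.restrict (box I)) ↔
      AEStronglyMeasurable
        (fun z : ℝ × (Fin d → ℝ) => F (i.insertNth (α := fun _ => ℝ) z.1 z.2))
        ((volume.restrict (I i)).prod (volume.restrict (box fun j => I (i.succAbove j)))) :=
  ((measurePreserving_insertNth I i).aestronglyMeasurable_comp_iff
    (MeasurableEquiv.measurableEmbedding _)).symm

theorem integral_box (F : (Fin (d + 1) → ℝ) → ℝ) :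
    ∫ ξ in box I, F ξ = ∫ z : ℝ × (Fin d → ℝ), F (i.insertNth (α := fun _ => ℝ) z.1 z.2)
      ∂((volume.restrict (I i)).prod (volume.restrict (box fun j => I (i.succAbove j)))) :=
  ((measurePreserving_insertNth I i).integral_comp' F).symm

theorem ae_box_iff {P : (Fin (d + 1) → ℝ) → Prop} :
    (∀ᵐ ξ ∂volume.restrict (box I), P ξ) ↔
      ∀ᵐ z : ℝ × (Fin d → ℝ)
        ∂((volume.restrict (I i)).prod (volume.restrict (box fun j => I (i.succAbove j)))),
        P (i.insertNth (α := fun _ => ℝ) z.1 z.2) := by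
  rw [← (measurePreserving_insertNth I i).map_eq,
    (MeasurableEquiv.measurableEmbedding _).ae_map_iff]
  rfl

variable {I i}

theorem integrable_mul_marginal {c : ℝ → ℝ} {F : (Fin (d + 1) → ℝ) → ℝ}
    (h : Integrable (fun ξ => c (ξ i) * F ξ) (volume.restrict (box I))) :
    Integrable (fun x => c x * marginal I F i x) (volume.restrict (I i)) := by
  have h1 := ((integrable_box_iff I i).1 h).integral_prod_left
  simp only [Fin.insertNth_apply_same, integral_const_mul] at h1
  exact h1

theorem integral_mul_marginal {c : ℝ → ℝ} {F : (Fin (d + 1) → ℝ) → ℝ}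
    (h : Integrable (fun ξ => c (ξ i) * F ξ) (volume.restrict (box I))) :
    ∫ ξ in box I, c (ξ i) * F ξ = ∫ x in I i, c x * marginal I F i x := by
  rw [integral_box I i, integral_prod _ ((integrable_box_iff I i).1 h)]
  simp only [Fin.insertNth_apply_same, integral_const_mul]
  rfl

theorem integrable_marginal {F : (Fin (d + 1) → ℝ) → ℝ}
    (h : Integrable F (volume.restrict (box I))) :
    Integrable (marginal I F i) (volume.restrict (I i)) := by
  simpa using integrable_mul_marginal (i := i) (c := fun _ => 1) (by simpa using h)

theorem integral_marginal {F : (Fin (d + 1) → ℝ) → ℝ}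
    (h : Integrable F (volume.restrict (box I))) :
    ∫ x in I i, marginal I F i x = ∫ ξ in box I, F ξ := by
  simpa using (integral_mul_marginal (i := i) (c := fun _ => 1) (by simpa using h)).symm

theorem integral_mul_coMarginal {c : (Fin d → ℝ) → ℝ} {F : (Fin (d + 1) → ℝ) → ℝ}
    (h : Integrable (fun ξ => c (i.removeNth ξ) * F ξ) (volume.restrict (box I))) :
    ∫ ξ in box I, c (i.removeNth ξ) * F ξ =
      ∫ y in box (fun j => I (i.succAbove j)), c y * coMarginal I F i y := by
  rw [integral_box I i, integral_prod_symm _ ((integrable_box_iff I i).1 h)]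
  simp only [Fin.removeNth_insertNth, integral_const_mul]
  rfl

theorem aestronglyMeasurable_marginal {F : (Fin (d + 1) → ℝ) → ℝ}
    (h : AEStronglyMeasurable F (volume.restrict (box I))) :
    AEStronglyMeasurable (marginal I F i) (volume.restrict (I i)) :=
  ((aestronglyMeasurable_box_iff I i).1 h).integral_prod_right'

theorem aestronglyMeasurable_coMarginal {F : (Fin (d + 1) → ℝ) → ℝ}
    (h : AEStronglyMeasurable F (volume.restrict (box I))) :
    AEStronglyMeasurable (coMarginal I F i)
      (volume.restrict (box fun j => I (i.succAbove j))) :=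
  ((aestronglyMeasurable_box_iff I i).1 h).prod_swap.integral_prod_right'

theorem aestronglyMeasurable_comp_eval {c : ℝ → ℝ}
    (h : AEStronglyMeasurable c (volume.restrict (I i))) :
    AEStronglyMeasurable (fun ξ : Fin (d + 1) → ℝ => c (ξ i)) (volume.restrict (box I)) := by
  rw [aestronglyMeasurable_box_iff I i]
  simp only [Fin.insertNth_apply_same]
  exact h.comp_fst

theorem aestronglyMeasurable_comp_removeNth {c : (Fin d → ℝ) → ℝ}
    (h : AEStronglyMeasurable c (volume.restrict (box fun j => I (i.succAbove j)))) :
    AEStronglyMeasurable (fun ξ : Fin (d + 1) → ℝ => c (i.removeNth ξ))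
      (volume.restrict (box I)) := by
  rw [aestronglyMeasurable_box_iff I i]
  simp only [Fin.removeNth_insertNth]
  exact h.comp_snd

theorem ae_comp_eval {P : ℝ → Prop} (h : ∀ᵐ x ∂volume.restrict (I i), P x) :
    ∀ᵐ ξ ∂volume.restrict (box I), P (ξ i) := by
  rw [ae_box_iff I i]
  simp only [Fin.insertNth_apply_same]
  exact Measure.quasiMeasurePreserving_fst.ae h

theorem ae_comp_removeNth {P : (Fin d → ℝ) → Prop}
    (h : ∀ᵐ y ∂volume.restrict (box fun j => I (i.succAbove j)), P y) :
    ∀ᵐ ξ ∂volume.restrict (box I), P (i.removeNth ξ) := by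
  rw [ae_box_iff I i]
  simp only [Fin.removeNth_insertNth]
  exact Measure.quasiMeasurePreserving_snd.ae h

theorem integral_eval_mul_removeNth (a : ℝ → ℝ) (b : (Fin d → ℝ) → ℝ) :
    ∫ ξ in box I, a (ξ i) * b (i.removeNth ξ) =
      (∫ x in I i, a x) * ∫ y in box (fun j => I (i.succAbove j)), b y := by
  rw [integral_box I i]
  simp only [Fin.removeNth_insertNth, Fin.insertNth_apply_same]
  exact integral_prod_mul a b

theorem marginal_mono {F G : (Fin (d + 1) → ℝ) → ℝ}
    (hF : Integrable F (volume.restrict (box I))) (hG : Integrable G (volume.restrict (box I)))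
    (h : ∀ᵐ ξ ∂volume.restrict (box I), F ξ ≤ G ξ) :
    ∀ᵐ x ∂volume.restrict (I i), marginal I F i x ≤ marginal I G i x := by
  filter_upwards [((integrable_box_iff I i).1 hF).prod_right_ae,
    ((integrable_box_iff I i).1 hG).prod_right_ae,
    Measure.ae_ae_of_ae_prod ((ae_box_iff I i).1 h)] with x h1 h2 h3
  exact integral_mono_ae h1 h2 h3

theorem marginal_nonneg {F : (Fin (d + 1) → ℝ) → ℝ}
    (h : ∀ᵐ ξ ∂volume.restrict (box I), 0 ≤ F ξ) :
    ∀ᵐ x ∂volume.restrict (I i), 0 ≤ marginal I F i x := by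
  filter_upwards [Measure.ae_ae_of_ae_prod ((ae_box_iff I i).1 h)] with x h3
  exact integral_nonneg_of_ae h3

end Box

/-! ### The measure `w dξ` and weighted marginals -/

theorem IsAdmissibleInterval.measurableSet {s : Set ℝ} (h : IsAdmissibleInterval s) :
    MeasurableSet s := by
  rcases h with ⟨b, rfl⟩ | ⟨a, rfl⟩ | ⟨a, b, _, rfl⟩ | rfl
  exacts [measurableSet_Iic, measurableSet_Ici, measurableSet_Icc, MeasurableSet.univ]

theorem measurableSet_box {n : ℕ} {I : Fin n → Set ℝ} (hI : ∀ i, MeasurableSet (I i)) :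
    MeasurableSet (box I) :=
  MeasurableSet.univ_pi hI

section Weight
variable {n : ℕ} {I : Fin n → Set ℝ} {w : (Fin n → ℝ) → ℝ}

theorem IsPositiveDensity.ae_pos (hw : IsPositiveDensity I w) (hI : ∀ i, MeasurableSet (I i)) :
    ∀ᵐ ξ ∂volume.restrict (box I), 0 < w ξ :=
  (ae_restrict_iff' (measurableSet_box hI)).2 (Eventually.of_forall hw.pos)

theorem IsPositiveDensity.aemeasurable (hw : IsPositiveDensity I w) :
    AEMeasurable (fun ξ => ENNReal.ofReal (w ξ)) (volume.restrict (box I)) :=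
  hw.integrableOn.1.aemeasurable.ennreal_ofReal

theorem ae_weightMeasure (hw : IsPositiveDensity I w) (hI : ∀ i, MeasurableSet (I i)) :
    ae (weightMeasure I w) = ae (volume.restrict (box I)) := by
  refine le_antisymm (withDensity_absolutelyContinuous _ _).ae_le
    (withDensity_absolutelyContinuous' hw.aemeasurable ?_).ae_le
  filter_upwards [hw.ae_pos hI] with ξ h
  simpa using h

theorem integrable_weightMeasure_iff (hw : IsPositiveDensity I w)
    (hI : ∀ i, MeasurableSet (I i)) {f : (Fin n → ℝ) → ℝ} :
    Integrable f (weightMeasure I w) ↔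
      Integrable (fun ξ => f ξ * w ξ) (volume.restrict (box I)) := by
  rw [weightMeasure, integrable_withDensity_iff_integrable_smul₀' hw.aemeasurable (by simp)]
  refine integrable_congr ?_
  filter_upwards [hw.ae_pos hI] with ξ h
  rw [ENNReal.toReal_ofReal h.le, smul_eq_mul, mul_comm]

theorem integral_weightMeasure (hw : IsPositiveDensity I w)
    (hI : ∀ i, MeasurableSet (I i)) (f : (Fin n → ℝ) → ℝ) :
    ∫ ξ, f ξ ∂weightMeasure I w = ∫ ξ in box I, f ξ * w ξ := by
  rw [weightMeasure, integral_withDensity_eq_integral_toReal_smul₀ hw.aemeasurable (by simp)]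
  refine integral_congr_ae ?_
  filter_upwards [hw.ae_pos hI] with ξ h
  rw [ENNReal.toReal_ofReal h.le, smul_eq_mul, mul_comm]

theorem isProbabilityMeasure_weightMeasure (hw : IsPositiveDensity I w)
    (hI : ∀ i, MeasurableSet (I i)) : IsProbabilityMeasure (weightMeasure I w) := by
  refine ⟨?_⟩
  rw [weightMeasure, withDensity_apply _ MeasurableSet.univ, Measure.restrict_univ,
    ← ofReal_integral_eq_lintegral_ofReal hw.integrableOn ((hw.ae_pos hI).mono fun _ h => h.le),
    hw.integral_eq_one, ENNReal.ofReal_one]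

theorem aestronglyMeasurable_weightMeasure (hw : IsPositiveDensity I w)
    (hI : ∀ i, MeasurableSet (I i)) {f : (Fin n → ℝ) → ℝ} :
    AEStronglyMeasurable f (weightMeasure I w) ↔
      AEStronglyMeasurable f (volume.restrict (box I)) := by
  have h := ae_weightMeasure hw hI
  constructor
  · rintro ⟨g, hg, hfg⟩
    refine ⟨g, hg, ?_⟩
    rwa [EventuallyEq, ← h]
  · rintro ⟨g, hg, hfg⟩
    refine ⟨g, hg, ?_⟩
    rwa [EventuallyEq, h]

end Weight

section Marginal
variable {d : ℕ} {I : Fin (d + 1) → Set ℝ} {w : (Fin (d + 1) → ℝ) → ℝ}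

theorem measurableSet_preimage_eval {s : Set ℝ} (hs : MeasurableSet s) (i : Fin (d + 1)) :
    MeasurableSet {ξ : Fin (d + 1) → ℝ | ξ i ∈ s} :=
  measurable_pi_apply i hs

theorem setIntegral_eval_eq (hw : IsPositiveDensity I w) (hI : ∀ i, MeasurableSet (I i))
    {f : (Fin (d + 1) → ℝ) → ℝ} (hf : Integrable f (weightMeasure I w)) (i : Fin (d + 1))
    {s : Set ℝ} (hs : MeasurableSet s) :
    ∫ ξ in {ξ | ξ i ∈ s}, f ξ ∂weightMeasure I w =
      ∫ x in s, weightedMarginal I w f i x ∂volume.restrict (I i) := by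
  have hS := measurableSet_preimage_eval hs i
  have e : ∀ ξ : Fin (d + 1) → ℝ, ({ξ | ξ i ∈ s} : Set (Fin (d + 1) → ℝ)).indicator f ξ * w ξ
      = s.indicator (fun _ => (1:ℝ)) (ξ i) * (f ξ * w ξ) := by
    intro ξ
    by_cases h : ξ i ∈ s
    · rw [Set.indicator_of_mem h, Set.indicator_of_mem (by exact h), one_mul]
    · rw [Set.indicator_of_notMem h, Set.indicator_of_notMem (by exact h)]; simp
  rw [← integral_indicator hS, integral_weightMeasure hw hI]
  simp_rw [e]
  rw [integral_mul_marginal, ← integral_indicator hs]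
  · congr 1
    funext x
    by_cases h : x ∈ s
    · simp [h, weightedMarginal]
    · simp [h]
  · simp_rw [← e]
    exact (integrable_weightMeasure_iff hw hI).1 (hf.indicator hS)

/-- Equality of weighted marginals is a family of linear conditions on integrals over sets, which
is stable under limits in `L^p(w)`. -/
theorem weightedMarginal_ae_eq_iff (hw : IsPositiveDensity I w) (hI : ∀ i, MeasurableSet (I i))
    {f g : (Fin (d + 1) → ℝ) → ℝ} (hf : Integrable f (weightMeasure I w))
    (hg : Integrable g (weightMeasure I w)) (i : Fin (d + 1)) :
    weightedMarginal I w f i =ᵐ[volume.restrict (I i)] weightedMarginal I w g i ↔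
      ∀ s : Set ℝ, MeasurableSet s →
        ∫ ξ in {ξ | ξ i ∈ s}, f ξ ∂weightMeasure I w =
          ∫ ξ in {ξ | ξ i ∈ s}, g ξ ∂weightMeasure I w := by
  constructor
  · intro h s hs
    rw [setIntegral_eval_eq hw hI hf i hs, setIntegral_eval_eq hw hI hg i hs]
    exact integral_congr_ae (ae_restrict_of_ae h)
  · intro h
    refine Integrable.ae_eq_of_forall_setIntegral_eq _ _
      (integrable_marginal ((integrable_weightMeasure_iff hw hI).1 hf))
      (integrable_marginal ((integrable_weightMeasure_iff hw hI).1 hg)) fun s hs _ => ?_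
    rw [← setIntegral_eval_eq hw hI hf i hs, ← setIntegral_eval_eq hw hI hg i hs, h s hs]

end Marginal

/-! ### Annihilators of the functions with zero marginals -/

section Decomposition
variable {d : ℕ} {I : Fin (d + 1) → Set ℝ} {w : (Fin (d + 1) → ℝ) → ℝ}

/-- The function `x ↦ ∫ φ(x, ξ_i^c) w_i^c(ξ_i^c) dξ_i^c`: the average of `φ` over `ξ_i^c` as if
`ξ_i` and `ξ_i^c` were independent. -/
def independentAverage (I : Fin (d + 1) → Set ℝ) (w φ : (Fin (d + 1) → ℝ) → ℝ)
    (i : Fin (d + 1)) : ℝ → ℝ :=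
  marginal I (fun ξ => φ ξ * coMarginal I w i (i.removeNth ξ)) i

/-- The image of the indicator function of `T` under the formal adjoint, with respect to `w dξ`, of
`φ ↦ independentAverage I w φ i`. It is dominated by the likelihood ratio `w_i w_i^c / w`. -/
def averageAdjoint (I : Fin (d + 1) → Set ℝ) (w : (Fin (d + 1) → ℝ) → ℝ)
    (T : Set (Fin (d + 1) → ℝ)) (i : Fin (d + 1)) (ξ : Fin (d + 1) → ℝ) : ℝ :=
  marginal I (T.indicator w) i (ξ i) * coMarginal I w i (i.removeNth ξ) / w ξ

theorem averageAdjoint_mul (hw : IsPositiveDensity I w) (hI : ∀ i, MeasurableSet (I i))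
    (T : Set (Fin (d + 1) → ℝ)) (i : Fin (d + 1)) :
    ∀ᵐ ξ ∂volume.restrict (box I), averageAdjoint I w T i ξ * w ξ =
      marginal I (T.indicator w) i (ξ i) * coMarginal I w i (i.removeNth ξ) := by
  filter_upwards [hw.ae_pos hI] with ξ h
  exact div_mul_cancel₀ _ h.ne'

theorem IsPositiveDensity.coMarginal_nonneg (hw : IsPositiveDensity I w)
    (hI : ∀ i, MeasurableSet (I i)) (i : Fin (d + 1)) :
    ∀ᵐ y ∂volume.restrict (box fun j => I (i.succAbove j)), 0 ≤ coMarginal I w i y := by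
  have h := (ae_box_iff I i).1 (hw.ae_pos hI)
  have h' := Measure.ae_ae_of_ae_prod (Measure.measurePreserving_swap.quasiMeasurePreserving.ae h)
  filter_upwards [h'] with y hy
  exact integral_nonneg_of_ae (hy.mono fun x hx => hx.le)

theorem indicator_le_density (hw : IsPositiveDensity I w) (hI : ∀ i, MeasurableSet (I i))
    (T : Set (Fin (d + 1) → ℝ)) : ∀ᵐ ξ ∂volume.restrict (box I),
      0 ≤ T.indicator w ξ ∧ T.indicator w ξ ≤ w ξ := by
  filter_upwards [hw.ae_pos hI] with ξ h
  by_cases hT : ξ ∈ T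
  · simp [hT, h.le]
  · simp [hT, h.le]

theorem integral_coMarginal_density (hw : IsPositiveDensity I w) (i : Fin (d + 1)) :
    ∫ y in box (fun j => I (i.succAbove j)), coMarginal I w i y = 1 := by
  have h := integral_mul_coMarginal (I := I) (i := i) (c := fun _ => 1) (F := w)
    (by simpa using! hw.integrableOn)
  simpa [hw.integral_eq_one] using h.symm

theorem memLp_averageAdjoint (hw : IsPositiveDensity I w) (hI : ∀ i, MeasurableSet (I i))
    {p : ℝ} {i : Fin (d + 1)} (hratio : MemWeightedLp p I w (likelihoodRatio I w i))
    {T : Set (Fin (d + 1) → ℝ)} (hT : MeasurableSet T) :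
    MemWeightedLp p I w (averageAdjoint I w T i) := by
  have hTw : Integrable (T.indicator w) (volume.restrict (box I)) := hw.integrableOn.indicator hT
  refine MemLp.of_le hratio ?_ ?_
  · rw [aestronglyMeasurable_weightMeasure hw hI]
    have h1 := aestronglyMeasurable_comp_eval (aestronglyMeasurable_marginal (i := i) hTw.1)
    have h2 := aestronglyMeasurable_comp_removeNth
      (aestronglyMeasurable_coMarginal (i := i) hw.integrableOn.1)
    exact ((h1.mul h2).aemeasurable.div hw.integrableOn.1.aemeasurable).aestronglyMeasurable
  · rw [ae_weightMeasure hw hI]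
    have hle := indicator_le_density hw hI T
    filter_upwards [hw.ae_pos hI, ae_comp_removeNth (hw.coMarginal_nonneg hI i),
      ae_comp_eval (marginal_nonneg (i := i) (hle.mono fun _ h => h.1)),
      ae_comp_eval (marginal_mono (i := i) hTw hw.integrableOn (hle.mono fun _ h => h.2))]
      with ξ h1 h2 h3 h4
    have h5 : averageAdjoint I w T i ξ ≤ likelihoodRatio I w i ξ := by
      unfold averageAdjoint likelihoodRatio
      gcongr
    have h6 : 0 ≤ averageAdjoint I w T i ξ := by unfold averageAdjoint; positivity
    rw [Real.norm_of_nonneg h6, Real.norm_of_nonneg (h6.trans h5)]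
    exact h5

theorem integrable_mul_marginal_mul_coMarginal (hw : IsPositiveDensity I w)
    (hI : ∀ i, MeasurableSet (I i)) {p q : ℝ} (hpq : p.HolderConjugate q) {i : Fin (d + 1)}
    (hratio : MemWeightedLp p I w (likelihoodRatio I w i)) {φ : (Fin (d + 1) → ℝ) → ℝ}
    (hφ : MemWeightedLp q I w φ) :
    Integrable (fun ξ => marginal I w i (ξ i) * (φ ξ * coMarginal I w i (i.removeNth ξ)))
      (volume.restrict (box I)) := by
  have := hpq.ennrealOfReal
  have h := (integrable_weightMeasure_iff hw hI).1 (MemLp.integrable_mul hratio hφ)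
  refine h.congr ?_
  filter_upwards [hw.ae_pos hI] with ξ hξ
  simp only [Pi.mul_apply, likelihoodRatio]
  field_simp

theorem aestronglyMeasurable_independentAverage (hw : IsPositiveDensity I w)
    (hI : ∀ i, MeasurableSet (I i)) {q : ℝ} {φ : (Fin (d + 1) → ℝ) → ℝ}
    (hφ : MemWeightedLp q I w φ) (i : Fin (d + 1)) :
    AEStronglyMeasurable (independentAverage I w φ i) (volume.restrict (I i)) :=
  aestronglyMeasurable_marginal (((aestronglyMeasurable_weightMeasure hw hI).1 hφ.1).mul
    (aestronglyMeasurable_comp_removeNth (aestronglyMeasurable_coMarginal hw.integrableOn.1)))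

theorem integrable_independentAverage (hw : IsPositiveDensity I w)
    (hI : ∀ i, MeasurableSet (I i)) {p q : ℝ} (hpq : p.HolderConjugate q) {i : Fin (d + 1)}
    (hratio : MemWeightedLp p I w (likelihoodRatio I w i)) {φ : (Fin (d + 1) → ℝ) → ℝ}
    (hφ : MemWeightedLp q I w φ) :
    Integrable (fun ξ => independentAverage I w φ i (ξ i)) (weightMeasure I w) := by
  rw [integrable_weightMeasure_iff hw hI, integrable_box_iff I i]
  have hA := aestronglyMeasurable_independentAverage hw hI hφ i
  have hwz := (integrable_box_iff I i).1 hw.integrableOn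
  have hint := integrable_mul_marginal
    (integrable_mul_marginal_mul_coMarginal hw hI hpq hratio hφ)
  simp only [Fin.insertNth_apply_same]
  refine (integrable_prod_iff (f := fun z : ℝ × (Fin d → ℝ) => independentAverage I w φ i z.1 *
    w (i.insertNth (α := fun _ => ℝ) z.1 z.2)) (hA.comp_fst.mul hwz.1)).2 ?_
  constructor
  · filter_upwards [hwz.prod_right_ae] with x hx
    exact hx.const_mul _
  · refine hint.abs.congr ?_
    filter_upwards [Measure.ae_ae_of_ae_prod ((ae_box_iff I i).1 (hw.ae_pos hI)),
      marginal_nonneg (i := i) ((hw.ae_pos hI).mono fun _ h => h.le)] with x hx hx'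
    have e : ∫ y in box (fun j => I (i.succAbove j)),
        ‖independentAverage I w φ i x * w (i.insertNth (α := fun _ => ℝ) x y)‖ =
        ∫ y in box (fun j => I (i.succAbove j)),
          |independentAverage I w φ i x| * w (i.insertNth (α := fun _ => ℝ) x y) := by
      refine integral_congr_ae ?_
      filter_upwards [hx] with y hy
      rw [norm_mul, Real.norm_eq_abs, Real.norm_of_nonneg hy.le]
    rw [e, integral_const_mul, abs_mul, abs_of_nonneg hx', mul_comm]
    rfl

theorem setIntegral_independentAverage (hw : IsPositiveDensity I w)
    (hI : ∀ i, MeasurableSet (I i)) {p q : ℝ} (hpq : p.HolderConjugate q) {i : Fin (d + 1)}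
    (hratio : MemWeightedLp p I w (likelihoodRatio I w i)) {φ : (Fin (d + 1) → ℝ) → ℝ}
    (hφ : MemWeightedLp q I w φ) {T : Set (Fin (d + 1) → ℝ)} (hT : MeasurableSet T) :
    ∫ ξ in T, independentAverage I w φ i (ξ i) ∂weightMeasure I w =
      ∫ ξ, φ ξ * averageAdjoint I w T i ξ ∂weightMeasure I w := by
  have hconj := hpq.symm.ennrealOfReal
  have e1 : ∀ ξ : Fin (d + 1) → ℝ,
      T.indicator (fun ξ => independentAverage I w φ i (ξ i)) ξ * w ξ
        = independentAverage I w φ i (ξ i) * T.indicator w ξ := by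
    intro ξ
    by_cases h : ξ ∈ T <;> simp [h]
  have e2 : (fun ξ => φ ξ * averageAdjoint I w T i ξ * w ξ) =ᵐ[volume.restrict (box I)]
      fun ξ => marginal I (T.indicator w) i (ξ i) *
        (φ ξ * coMarginal I w i (i.removeNth ξ)) := by
    filter_upwards [averageAdjoint_mul hw hI T i] with ξ h
    rw [mul_assoc, h]
    ring
  have i1 := (integrable_weightMeasure_iff hw hI).1
    ((integrable_independentAverage hw hI hpq hratio hφ).indicator hT)
  have i2 := (integrable_weightMeasure_iff hw hI).1
    (MemLp.integrable_mul hφ (memLp_averageAdjoint hw hI hratio hT))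
  simp_rw [e1] at i1
  rw [← integral_indicator hT, integral_weightMeasure hw hI, integral_weightMeasure hw hI,
    integral_congr_ae e2]
  simp_rw [e1]
  rw [integral_mul_marginal i1, integral_mul_marginal (i2.congr e2)]
  simp_rw [mul_comm (independentAverage I w φ i _)]
  rfl

theorem setIntegral_averageAdjoint_same (hw : IsPositiveDensity I w)
    (hI : ∀ i, MeasurableSet (I i)) {T : Set (Fin (d + 1) → ℝ)} (hT : MeasurableSet T)
    (i : Fin (d + 1)) {s : Set ℝ} (hs : MeasurableSet s) :
    ∫ ξ in {ξ | ξ i ∈ s}, averageAdjoint I w T i ξ ∂weightMeasure I w =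
      ∫ ξ in {ξ | ξ i ∈ s}, T.indicator (fun _ => (1 : ℝ)) ξ ∂weightMeasure I w := by
  have := isProbabilityMeasure_weightMeasure hw hI
  have hS := measurableSet_preimage_eval hs i
  have hTi : Integrable (T.indicator fun _ => (1 : ℝ)) (weightMeasure I w) :=
    (integrable_const 1).indicator hT
  have e : (fun ξ => ({ξ | ξ i ∈ s} : Set (Fin (d + 1) → ℝ)).indicator
      (averageAdjoint I w T i) ξ * w ξ) =ᵐ[volume.restrict (box I)]
      fun ξ => s.indicator (marginal I (T.indicator w) i) (ξ i)
        * coMarginal I w i (i.removeNth ξ) := by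
    filter_upwards [averageAdjoint_mul hw hI T i] with ξ h
    by_cases hξ : ξ i ∈ s
    · rw [Set.indicator_of_mem hξ, Set.indicator_of_mem (by exact hξ), h]
    · rw [Set.indicator_of_notMem hξ, Set.indicator_of_notMem (by exact hξ)]; simp
  rw [setIntegral_eval_eq hw hI hTi i hs, ← integral_indicator hS, integral_weightMeasure hw hI,
    integral_congr_ae e, integral_eval_mul_removeNth, integral_coMarginal_density hw, mul_one,
    integral_indicator hs]
  have e' : (fun ξ => T.indicator (fun _ => (1 : ℝ)) ξ * w ξ) = T.indicator w := by
    funext ξ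
    by_cases h : ξ ∈ T <;> simp [h]
  rw [weightedMarginal, e']

theorem setIntegral_averageAdjoint_of_ne (hw : IsPositiveDensity I w)
    (hI : ∀ i, MeasurableSet (I i)) {T : Set (Fin (d + 1) → ℝ)} (hT : MeasurableSet T)
    {i j : Fin (d + 1)} (hij : j ≠ i) {s : Set ℝ} (hs : MeasurableSet s) :
    ∫ ξ in {ξ | ξ j ∈ s}, averageAdjoint I w T i ξ ∂weightMeasure I w =
      (weightMeasure I w).real T * (weightMeasure I w).real {ξ | ξ j ∈ s} := by
  have := isProbabilityMeasure_weightMeasure hw hI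
  obtain ⟨j, rfl⟩ := Fin.exists_succAbove_eq hij
  have hS := measurableSet_preimage_eval hs (i.succAbove j)
  have e : (fun ξ => ({ξ | ξ (i.succAbove j) ∈ s} : Set (Fin (d + 1) → ℝ)).indicator
      (averageAdjoint I w T i) ξ * w ξ) =ᵐ[volume.restrict (box I)]
      fun ξ => marginal I (T.indicator w) i (ξ i) *
        (fun y : Fin d → ℝ => s.indicator (fun _ => (1 : ℝ)) (y j) * coMarginal I w i y)
          (i.removeNth ξ) := by
    filter_upwards [averageAdjoint_mul hw hI T i] with ξ h
    have hr : i.removeNth ξ j = ξ (i.succAbove j) := rfl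
    simp only [hr]
    by_cases hξ : ξ (i.succAbove j) ∈ s
    · rw [Set.indicator_of_mem hξ, Set.indicator_of_mem (by exact hξ), h, one_mul]
    · rw [Set.indicator_of_notMem hξ, Set.indicator_of_notMem (by exact hξ)]; simp
  have hreal : ∀ {S : Set (Fin (d + 1) → ℝ)}, MeasurableSet S →
      (weightMeasure I w).real S = ∫ ξ in box I, S.indicator w ξ := by
    intro S hS
    rw [← integral_indicator_one hS, integral_weightMeasure hw hI]
    congr 1
    funext ξ
    by_cases h : ξ ∈ S <;> simp [h]
  have e2 : ∀ ξ : Fin (d + 1) → ℝ,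
      ({ξ | ξ (i.succAbove j) ∈ s} : Set (Fin (d + 1) → ℝ)).indicator w ξ =
      (fun y : Fin d → ℝ => s.indicator (fun _ => (1 : ℝ)) (y j)) (i.removeNth ξ) * w ξ := by
    intro ξ
    have hr : i.removeNth ξ j = ξ (i.succAbove j) := rfl
    simp only [hr]
    by_cases hξ : ξ (i.succAbove j) ∈ s
    · rw [Set.indicator_of_mem hξ, Set.indicator_of_mem (by exact hξ), one_mul]
    · rw [Set.indicator_of_notMem hξ, Set.indicator_of_notMem (by exact hξ), zero_mul]
  rw [← integral_indicator hS, integral_weightMeasure hw hI, integral_congr_ae e,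
    integral_eval_mul_removeNth (marginal I (T.indicator w) i)
      (fun y : Fin d → ℝ => s.indicator (fun _ => (1 : ℝ)) (y j) * coMarginal I w i y),
    integral_marginal (hw.integrableOn.indicator hT), hreal hT,
    hreal hS]
  congr 1
  have i2 := hw.integrableOn.indicator hS
  have i2' : Integrable (fun ξ => (fun y : Fin d → ℝ => s.indicator (fun _ => (1 : ℝ)) (y j))
      (i.removeNth ξ) * w ξ) (volume.restrict (box I)) :=
    i2.congr (Eventually.of_forall e2)
  rw [integral_congr_ae (Eventually.of_forall e2)]
  exact (integral_mul_coMarginal (c := fun y : Fin d → ℝ => s.indicator (fun _ => (1 : ℝ)) (y j))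
    i2').symm

/-- The annihilator in `L^q(w)` of the functions in `L^p(w)` with zero weighted marginals consists
of sums of functions of one variable. The summands are explicit: for `φ = ∑ Ψ_i(ξ_i)` the
independent average of `φ` over `ξ_i^c` is `Ψ_i + ∑_{j ≠ i} ∫ Ψ_j w_j`, whence
`φ = ∑ (independent averages) - d ∫ φ w`. In general this identity is tested against indicator
functions, where the adjoint of `φ ↦ φ - ∑ (independent averages) + d ∫ φ w` maps into the functions
with zero marginals. -/
theorem eq_sum_independentAverage (hw : IsPositiveDensity I w)
    (hI : ∀ i, MeasurableSet (I i)) {p q : ℝ} (hpq : p.HolderConjugate q)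
    (hratio : ∀ i, MemWeightedLp p I w (likelihoodRatio I w i)) {φ : (Fin (d + 1) → ℝ) → ℝ}
    (hφ : MemWeightedLp q I w φ)
    (horth : ∀ h : (Fin (d + 1) → ℝ) → ℝ, MemWeightedLp p I w h →
      (∀ i, ∀ s : Set ℝ, MeasurableSet s → ∫ ξ in {ξ | ξ i ∈ s}, h ξ ∂weightMeasure I w = 0) →
      ∫ ξ, φ ξ * h ξ ∂weightMeasure I w = 0) :
    φ =ᵐ[weightMeasure I w] fun ξ =>
      ∑ i, independentAverage I w φ i (ξ i) - d * ∫ ξ, φ ξ ∂weightMeasure I w := by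
  have := isProbabilityMeasure_weightMeasure hw hI
  have hconj := hpq.symm.ennrealOfReal
  have hp1 : (1 : ENNReal) ≤ ENNReal.ofReal p := by
    simpa using ENNReal.ofReal_le_ofReal hpq.lt.le
  have hq1 : (1 : ENNReal) ≤ ENNReal.ofReal q := by
    simpa using ENNReal.ofReal_le_ofReal hpq.symm.lt.le
  have hφi : Integrable φ (weightMeasure I w) := hφ.integrable hq1
  have hAi := fun i => integrable_independentAverage hw hI hpq (hratio i) hφ
  have hsum : Integrable (fun ξ => ∑ i, independentAverage I w φ i (ξ i)) (weightMeasure I w) :=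
    integrable_finsetSum _ fun i _ => hAi i
  refine Integrable.ae_eq_of_forall_setIntegral_eq _ _ hφi
    (hsum.sub (integrable_const _)) fun T hT _ => ?_
  set μ := weightMeasure I w with hμ
  have hk := fun i => memLp_averageAdjoint hw hI (hratio i) hT
  have hki : ∀ i, Integrable (averageAdjoint I w T i) μ := fun i => (hk i).integrable hp1
  have h1 : MemLp (T.indicator fun _ => (1 : ℝ)) (ENNReal.ofReal p) μ :=
    (memLp_const 1).indicator hT
  have hksum : MemLp (fun ξ => ∑ i, averageAdjoint I w T i ξ) (ENNReal.ofReal p) μ :=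
    memLp_finsetSum _ fun i _ => hk i
  have hc : MemLp (fun _ : Fin (d + 1) → ℝ => (d : ℝ) * μ.real T) (ENNReal.ofReal p) μ :=
    memLp_const _
  have key := horth (fun ξ => T.indicator (fun _ => (1 : ℝ)) ξ - ∑ i, averageAdjoint I w T i ξ
    + d * μ.real T) ((h1.sub hksum).add hc) ?_
  · -- expand `∫ φ h = 0` and move the adjoints back to `φ`
    have i1 : Integrable (fun ξ => φ ξ * T.indicator (fun _ => (1 : ℝ)) ξ) μ :=
      hφ.integrable_mul h1
    have i2 : ∀ i, Integrable (fun ξ => φ ξ * averageAdjoint I w T i ξ) μ :=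
      fun i => MemLp.integrable_mul hφ (hk i)
    have i2' : Integrable (fun ξ => ∑ i, φ ξ * averageAdjoint I w T i ξ) μ :=
      integrable_finsetSum _ fun i _ => i2 i
    have i3 : Integrable (fun ξ => φ ξ * (d * μ.real T)) μ := hφi.mul_const _
    have i4 : Integrable (fun ξ => φ ξ * T.indicator (fun _ => (1 : ℝ)) ξ
        - ∑ i, φ ξ * averageAdjoint I w T i ξ) μ := i1.sub i2'
    simp_rw [mul_add, mul_sub, Finset.mul_sum] at key
    rw [integral_add i4 i3, integral_sub i1 i2', integral_finsetSum _ fun i _ => i2 i,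
      integral_mul_const, Finset.sum_congr rfl fun i _ =>
        (setIntegral_independentAverage hw hI hpq (hratio i) hφ hT).symm] at key
    have e1 : ∫ ξ, φ ξ * T.indicator (fun _ => (1 : ℝ)) ξ ∂μ = ∫ ξ in T, φ ξ ∂μ := by
      rw [← integral_indicator hT]
      congr 1
      funext ξ
      by_cases h : ξ ∈ T <;> simp [h]
    rw [e1] at key
    rw [integral_sub hsum.integrableOn (integrable_const _).integrableOn,
      integral_finsetSum _ fun i _ => (hAi i).integrableOn, setIntegral_const, smul_eq_mul]
    linarith
  · -- the marginals of `h` vanish: the term `i = j` cancels the indicator function of `T`, and the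
    -- `d` other terms cancel the constant
    intro j s hs
    have hksum' := hksum.integrable hp1
    have h1' := h1.integrable hp1
    have h2' : Integrable (fun ξ => T.indicator (fun _ => (1 : ℝ)) ξ
        - ∑ i, averageAdjoint I w T i ξ) μ := h1'.sub hksum'
    rw [integral_add h2'.integrableOn (hc.integrable hp1).integrableOn,
      integral_sub h1'.integrableOn hksum'.integrableOn,
      integral_finsetSum _ fun i _ => (hki i).integrableOn, setIntegral_const, smul_eq_mul,
      Fin.sum_univ_succAbove _ j, setIntegral_averageAdjoint_same hw hI hT j hs,
      Finset.sum_congr rfl fun i _ =>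
        setIntegral_averageAdjoint_of_ne hw hI hT (Fin.succAbove_ne j i).symm hs]
    simp
    ring

end Decomposition

/-! ### The signed power and its inverse -/

theorem abs_sign_mul_abs_rpow {r : ℝ} (hr : r ≠ 0) (x : ℝ) :
    |Real.sign x * |x| ^ r| = |x| ^ r := by
  rcases eq_or_ne x 0 with rfl | hx
  · simp [Real.zero_rpow hr]
  · have : |Real.sign x| = 1 := by
      rcases lt_or_gt_of_ne hx with h | h
      · simp [Real.sign_of_neg h]
      · simp [Real.sign_of_pos h]
    rw [abs_mul, this, one_mul, abs_of_nonneg (Real.rpow_nonneg (abs_nonneg x) _)]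

theorem sign_mul_abs (x : ℝ) : Real.sign x * |x| = x := by
  rcases lt_trichotomy x 0 with h | rfl | h
  · simp [Real.sign_of_neg h, abs_of_neg h]
  · simp
  · simp [Real.sign_of_pos h, abs_of_pos h]

theorem abs_signedPower_rpow {p : ℝ} (hp : 1 < p) (x : ℝ) :
    |Real.sign x * |x| ^ (1 / (p - 1))| ^ p = |x| ^ (p / (p - 1)) := by
  have : p - 1 ≠ 0 := by linarith
  rw [abs_sign_mul_abs_rpow (one_div_ne_zero this), ← Real.rpow_mul (abs_nonneg x)]
  congr 1
  ring

/-- The duality map `y ↦ |y|^{p-2} y` inverts `x ↦ sign(x) |x|^{1/(p-1)}`. -/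
theorem dualityMap_signedPower {p : ℝ} (hp : 1 < p) (x : ℝ) :
    |Real.sign x * |x| ^ (1 / (p - 1))| ^ (p - 2) * (Real.sign x * |x| ^ (1 / (p - 1))) = x := by
  have hp1 : p - 1 ≠ 0 := by linarith
  rcases eq_or_ne x 0 with rfl | hx
  · simp
  · have hx' := abs_pos.2 hx
    rw [abs_sign_mul_abs_rpow (one_div_ne_zero hp1), ← Real.rpow_mul (abs_nonneg x),
      mul_left_comm, ← Real.rpow_add hx']
    have : 1 / (p - 1) * (p - 2) + 1 / (p - 1) = 1 := by field_simp; ring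
    rw [this, Real.rpow_one, sign_mul_abs]

theorem signedPower_dualityMap {p : ℝ} (hp : 1 < p) (x : ℝ) :
    Real.sign (|x| ^ (p - 2) * x) * |(|x| ^ (p - 2) * x)| ^ (1 / (p - 1)) = x := by
  have hp1 : p - 1 ≠ 0 := by linarith
  rcases eq_or_ne x 0 with rfl | hx
  · simp
  · have hx' := Real.rpow_pos_of_pos (abs_pos.2 hx) (p - 2)
    have hs : Real.sign (|x| ^ (p - 2) * x) = Real.sign x := by
      rcases lt_or_gt_of_ne hx with h | h
      · rw [Real.sign_of_neg h, Real.sign_of_neg (mul_neg_of_pos_of_neg hx' h)]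
      · rw [Real.sign_of_pos h, Real.sign_of_pos (mul_pos hx' h)]
    rw [hs, abs_rpow_sub_two_mul_self hp, ← Real.rpow_mul (abs_nonneg x),
      mul_one_div_cancel hp1, Real.rpow_one, sign_mul_abs]

/-- The map `x ↦ sign(x) |x|^{1/(p-1)}` is strictly monotone. -/
theorem sub_mul_signedPower_sub_pos {p : ℝ} (hp : 1 < p) {a b : ℝ} (hab : a ≠ b) :
    0 < (a - b) * (Real.sign a * |a| ^ (1 / (p - 1)) - Real.sign b * |b| ^ (1 / (p - 1))) := by
  have ha := dualityMap_signedPower hp a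
  have hb := dualityMap_signedPower hp b
  generalize Real.sign a * |a| ^ (1 / (p - 1)) = x at ha ⊢
  generalize Real.sign b * |b| ^ (1 / (p - 1)) = y at hb ⊢
  have hne : x ≠ y := by
    rintro rfl
    exact hab (ha.symm.trans hb)
  -- add the tangent inequalities at the two points
  have h1 := tangent_lt_abs_rpow hp hne
  have h2 := tangent_lt_abs_rpow hp hne.symm
  rw [ha] at h1
  rw [hb] at h2
  have h3 : 0 < p * ((a - b) * (x - y)) := by linarith
  exact pos_of_mul_pos_right h3 (by linarith)

theorem sub_mul_signedPower_sub_nonneg {p : ℝ} (hp : 1 < p) (a b : ℝ) :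
    0 ≤ (a - b) * (Real.sign a * |a| ^ (1 / (p - 1)) - Real.sign b * |b| ^ (1 / (p - 1))) := by
  rcases eq_or_ne a b with rfl | h
  · simp
  · exact (sub_mul_signedPower_sub_pos hp h).le

theorem memLp_dualityMap {α : Type*} {m : MeasurableSpace α} {μ : Measure α} {p : ℝ} (hp : 1 < p)
    {f : α → ℝ} (hf : MemLp f (ENNReal.ofReal p) μ) :
    MemLp (fun x => |f x| ^ (p - 2) * f x) (ENNReal.ofReal (p / (p - 1))) μ := by
  have hq : 0 < p / (p - 1) := div_pos (by linarith) (by linarith)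
  have hm : Measurable fun x : ℝ => |x| ^ (p - 2) * x := by fun_prop
  refine (integrable_norm_rpow_iff (hm.comp_aemeasurable hf.1.aemeasurable).aestronglyMeasurable
    (by simpa using hq) (by simp)).1 ?_
  rw [ENNReal.toReal_ofReal hq.le]
  refine (integrable_abs_rpow hp hf).congr (Eventually.of_forall fun x => ?_)
  have hp1 : p - 1 ≠ 0 := by linarith
  simp only [Function.comp_apply, Real.norm_eq_abs]
  rw [abs_rpow_sub_two_mul_self hp, ← Real.rpow_mul (abs_nonneg _), mul_div_cancel₀ _ hp1]

/-! ### Existence of a solution -/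

section Solution
variable {d : ℕ} {I : Fin (d + 1) → Set ℝ} {w : (Fin (d + 1) → ℝ) → ℝ} {p : ℝ}

theorem exists_isSolution_le (hp : 1 < p) (hI : ∀ i, MeasurableSet (I i))
    (hw : IsPositiveDensity I w)
    (hratio : ∀ i, MemWeightedLp p I w (likelihoodRatio I w i))
    {g : (Fin (d + 1) → ℝ) → ℝ} (hg : MemWeightedLp p I w g) :
    ∃ Φ : Fin (d + 1) → ℝ → ℝ, IsSolution p I w (weightedMarginal I w g) Φ ∧
      ∀ f : (Fin (d + 1) → ℝ) → ℝ, MemWeightedLp p I w f →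
        (∀ i, weightedMarginal I w f i =ᵐ[volume.restrict (I i)] weightedMarginal I w g i) →
        ∫ ξ in box I, |average Φ ξ| ^ (p / (p - 1)) * w ξ ≤ ∫ ξ in box I, |f ξ| ^ p * w ξ := by
  have hprob := isProbabilityMeasure_weightMeasure hw hI
  have hpq : p.HolderConjugate (p / (p - 1)) := (Real.holderConjugate_iff_eq_conjExponent hp).2 rfl
  have hp1 : (1 : ENNReal) ≤ ENNReal.ofReal p := by simpa using ENNReal.ofReal_le_ofReal hp.le
  obtain ⟨f, hf, hfS, hmin⟩ := exists_minimizer_of_setIntegral_eq hp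
    {T : Set (Fin (d + 1) → ℝ) | ∃ i, ∃ s : Set ℝ, MeasurableSet s ∧ T = {ξ | ξ i ∈ s}} hg
  set φ : (Fin (d + 1) → ℝ) → ℝ := fun ξ => |f ξ| ^ (p - 2) * f ξ with hφ_def
  have hφ : MemWeightedLp (p / (p - 1)) I w φ := memLp_dualityMap hp hf
  have horth : ∀ h : (Fin (d + 1) → ℝ) → ℝ, MemWeightedLp p I w h →
      (∀ i, ∀ s : Set ℝ, MeasurableSet s → ∫ ξ in {ξ | ξ i ∈ s}, h ξ ∂weightMeasure I w = 0) →
      ∫ ξ, φ ξ * h ξ ∂weightMeasure I w = 0 := by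
    intro h hh h0
    refine integral_mul_eq_zero_of_minimal hp hf hh fun t =>
      hmin (fun ξ => f ξ + t * h ξ) (MemLp.add hf (MemLp.const_mul hh t)) ?_
    rintro _ ⟨i, s, hs, rfl⟩
    rw [integral_add (hf.integrable hp1).integrableOn
      ((MemLp.integrable hp1 hh).const_mul t).integrableOn, integral_const_mul, h0 i s hs,
      mul_zero, add_zero]
    exact hfS _ ⟨i, s, hs, rfl⟩
  have hdec := eq_sum_independentAverage hw hI hpq hratio hφ horth
  have hAi := fun i => integrable_independentAverage hw hI hpq (hratio i) hφ
  set A := independentAverage I w φ with hA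
  -- constants that centre all summands but the first and add up to `d ∫ φ w`
  set c : Fin (d + 1) → ℝ := fun i => ∫ ξ, A i (ξ i) ∂weightMeasure I w with hc
  set K : Fin (d + 1) → ℝ := Fin.cons
    (d * ∫ ξ, φ ξ ∂weightMeasure I w - ∑ j : Fin d, c j.succ) (fun j => c j.succ) with hK
  have hKc : ∀ i, i ≠ 0 → K i = c i := by
    intro i hi
    obtain ⟨j, rfl⟩ := Fin.exists_succ_eq.2 hi
    simp [hK]
  have hKsum : ∑ i, K i = d * ∫ ξ, φ ξ ∂weightMeasure I w := by
    rw [Fin.sum_univ_succ]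
    simp [hK]
  set Φ : Fin (d + 1) → ℝ → ℝ := fun i x => ((d + 1 : ℕ) : ℝ) * (A i x - K i) with hΦ
  have hΦi : ∀ i, Integrable (fun ξ => Φ i (ξ i)) (weightMeasure I w) :=
    fun i => ((hAi i).sub (integrable_const (K i))).const_mul _
  have havg : average Φ =ᵐ[weightMeasure I w] φ := by
    filter_upwards [hdec] with ξ hξ
    have hd : ((d + 1 : ℕ) : ℝ) ≠ 0 := by positivity
    rw [hξ, average, ← Finset.mul_sum, one_div, inv_mul_cancel_left₀ hd, Finset.sum_sub_distrib,
      hKsum]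
  have hsp : signedPower p (average Φ) =ᵐ[weightMeasure I w] f := by
    filter_upwards [havg] with ξ hξ
    rw [signedPower, hξ]
    exact signedPower_dualityMap hp (f ξ)
  refine ⟨Φ, ⟨fun i => ?_, hf.ae_eq hsp.symm, fun i => ?_, fun i hi => ?_⟩, fun f' hf' hm => ?_⟩
  · rw [MemWeightedLp, ENNReal.ofReal_one, memLp_one_iff_integrable]
    exact hΦi i
  · have hspi : Integrable (signedPower p (average Φ)) (weightMeasure I w) :=
      (hf.integrable hp1).congr hsp.symm
    refine (weightedMarginal_ae_eq_iff hw hI hspi (MemLp.integrable hp1 hg) i).2 fun s hs => ?_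
    rw [← hfS _ ⟨i, s, hs, rfl⟩]
    exact integral_congr_ae (ae_restrict_of_ae hsp)
  · rw [← integral_mul_marginal (i := i) (c := Φ i) (F := w)
      ((integrable_weightMeasure_iff hw hI).1 (hΦi i)), ← integral_weightMeasure hw hI
      (fun ξ => Φ i (ξ i)), integral_const_mul, integral_sub (hAi i) (integrable_const _),
      integral_const, hKc i hi]
    simp [hc]
  · have h1 := hmin f' hf' (by
      rintro _ ⟨i, s, hs, rfl⟩
      exact (weightedMarginal_ae_eq_iff hw hI (MemLp.integrable hp1 hf')
        (MemLp.integrable hp1 hg) i).1 (hm i) s hs)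
    rw [integral_weightMeasure hw hI, integral_weightMeasure hw hI] at h1
    refine le_trans (le_of_eq (integral_congr_ae ?_)) h1
    have hsp' := hsp
    rw [EventuallyEq, ae_weightMeasure hw hI] at hsp'
    filter_upwards [hsp'] with ξ hξ
    rw [← hξ, signedPower, abs_signedPower_rpow hp]

/-! ### Uniqueness, the bound and the case of equality -/

/-- A sum of one-variable functions in `L^q(w)` annihilates differences of functions in `L^p(w)`
with equal marginals. -/
theorem integral_average_mul_sub_eq_zero {q : ℝ} (hpq : p.HolderConjugate q)
    (hI : ∀ i, MeasurableSet (I i)) (hw : IsPositiveDensity I w) {Φ : Fin (d + 1) → ℝ → ℝ}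
    (hΦ : ∀ i, MemWeightedLp q I w (fun ξ => Φ i (ξ i))) {F G : (Fin (d + 1) → ℝ) → ℝ}
    (hF : MemWeightedLp p I w F) (hG : MemWeightedLp p I w G)
    (hFG : ∀ i, weightedMarginal I w F i =ᵐ[volume.restrict (I i)] weightedMarginal I w G i) :
    ∫ ξ, average Φ ξ * (F ξ - G ξ) ∂weightMeasure I w = 0 := by
  have hconj := hpq.symm.ennrealOfReal
  have hi : ∀ {H : (Fin (d + 1) → ℝ) → ℝ}, MemWeightedLp p I w H → ∀ i,
      Integrable (fun ξ => Φ i (ξ i) * H ξ) (weightMeasure I w) :=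
    fun hH i => MemLp.integrable_mul (hΦ i) hH
  have hval : ∀ {H : (Fin (d + 1) → ℝ) → ℝ}, MemWeightedLp p I w H → ∀ i,
      ∫ ξ, Φ i (ξ i) * H ξ ∂weightMeasure I w = ∫ x in I i, Φ i x * weightedMarginal I w H i x := by
    intro H hH i
    have h1 := (integrable_weightMeasure_iff hw hI).1 (hi hH i)
    rw [integral_weightMeasure hw hI]
    simp_rw [mul_assoc] at h1 ⊢
    exact integral_mul_marginal h1
  have hsub : ∀ i, Integrable (fun ξ => Φ i (ξ i) * (F ξ - G ξ)) (weightMeasure I w) := by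
    intro i
    simp_rw [mul_sub]
    exact (hi hF i).sub (hi hG i)
  simp_rw [average, mul_assoc, Finset.sum_mul]
  rw [integral_const_mul, integral_finsetSum _ fun i _ => hsub i, Finset.sum_eq_zero, mul_zero]
  intro i _
  simp_rw [mul_sub]
  rw [integral_sub (hi hF i) (hi hG i), hval hF, hval hG, sub_eq_zero]
  refine integral_congr_ae ?_
  filter_upwards [hFG i] with x hx
  rw [hx]

theorem dualityMap_signedPower_average (hp : 1 < p) (Φ : Fin (d + 1) → ℝ → ℝ)
    (ξ : Fin (d + 1) → ℝ) :
    |signedPower p (average Φ) ξ| ^ (p - 2) * signedPower p (average Φ) ξ = average Φ ξ :=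
  dualityMap_signedPower hp _

theorem IsSolution.memLp_of_smirnov {γ Φ : Fin (d + 1) → ℝ → ℝ} (hp : 1 < p)
    (hS : Smirnov (p / (p - 1)) I w) (hΦ : IsSolution p I w γ Φ) (i : Fin (d + 1)) :
    MemWeightedLp (p / (p - 1)) I w (fun ξ => Φ i (ξ i)) := by
  refine hS Φ hΦ.memLp_one ?_ i
  have h := memLp_dualityMap hp hΦ.memLp
  simp_rw [dualityMap_signedPower_average hp] at h
  exact h

/-- The excess of `|g|^p` over the tangent at `f = sign(Φ̄)|Φ̄|^{1/(p-1)}` integrates to the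
difference of the `p`-th powers of the norms, because `Φ̄` annihilates `g - f`. -/
theorem IsSolution.integral_excess {g : (Fin (d + 1) → ℝ) → ℝ} {Φ : Fin (d + 1) → ℝ → ℝ}
    (hp : 1 < p) (hI : ∀ i, MeasurableSet (I i)) (hw : IsPositiveDensity I w)
    (hS : Smirnov (p / (p - 1)) I w) (hg : MemWeightedLp p I w g)
    (hΦ : IsSolution p I w (weightedMarginal I w g) Φ) :
    Integrable (fun ξ => |g ξ| ^ p - (|signedPower p (average Φ) ξ| ^ p
        + p * average Φ ξ * (g ξ - signedPower p (average Φ) ξ))) (weightMeasure I w) ∧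
    ∫ ξ, (|g ξ| ^ p - (|signedPower p (average Φ) ξ| ^ p
        + p * average Φ ξ * (g ξ - signedPower p (average Φ) ξ))) ∂weightMeasure I w =
      ∫ ξ, |g ξ| ^ p ∂weightMeasure I w -
        ∫ ξ, |signedPower p (average Φ) ξ| ^ p ∂weightMeasure I w := by
  have hpq : p.HolderConjugate (p / (p - 1)) := (Real.holderConjugate_iff_eq_conjExponent hp).2 rfl
  have hconj := hpq.symm.ennrealOfReal
  have hΦq := hΦ.memLp_of_smirnov hp hS
  have havg : MemLp (average Φ) (ENNReal.ofReal (p / (p - 1))) (weightMeasure I w) :=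
    (memLp_finsetSum _ fun i _ => hΦq i).const_mul _
  have i1 := integrable_abs_rpow hp hg
  have i2 := integrable_abs_rpow hp hΦ.memLp
  have i3 : Integrable (fun ξ => p * average Φ ξ * (g ξ - signedPower p (average Φ) ξ))
      (weightMeasure I w) := by
    simp_rw [mul_assoc]
    exact (havg.integrable_mul (MemLp.sub hg hΦ.memLp)).const_mul p
  have i4 : Integrable (fun ξ => |signedPower p (average Φ) ξ| ^ p
      + p * average Φ ξ * (g ξ - signedPower p (average Φ) ξ)) (weightMeasure I w) := i2.add i3
  refine ⟨i1.sub i4, ?_⟩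
  rw [integral_sub i1 i4, integral_add i2 i3]
  simp_rw [mul_assoc]
  rw [integral_const_mul, integral_average_mul_sub_eq_zero hpq hI hw hΦq hg hΦ.memLp
    fun i => (hΦ.marginal_eq i).symm, mul_zero, add_zero]

theorem average_sub (Φ Ψ : Fin (d + 1) → ℝ → ℝ) (ξ : Fin (d + 1) → ℝ) :
    average (fun i x => Φ i x - Ψ i x) ξ = average Φ ξ - average Ψ ξ := by
  simp only [average, Finset.sum_sub_distrib, mul_sub]

/-- The averages of two solutions agree: `Φ̄ - Ψ̄` annihilates the difference of the two functions
`sign(·)|·|^{1/(p-1)}`, and the product of these differences is nonnegative. -/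
theorem IsSolution.average_ae_eq {γ Φ Ψ : Fin (d + 1) → ℝ → ℝ}
    (hp : 1 < p) (hI : ∀ i, MeasurableSet (I i)) (hw : IsPositiveDensity I w)
    (hS : Smirnov (p / (p - 1)) I w) (hΦ : IsSolution p I w γ Φ) (hΨ : IsSolution p I w γ Ψ) :
    average Φ =ᵐ[volume.restrict (box I)] average Ψ := by
  have hpq : p.HolderConjugate (p / (p - 1)) := (Real.holderConjugate_iff_eq_conjExponent hp).2 rfl
  have hconj := hpq.symm.ennrealOfReal
  have hq : ∀ i, MemWeightedLp (p / (p - 1)) I w (fun ξ => Φ i (ξ i) - Ψ i (ξ i)) :=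
    fun i => MemLp.sub (hΦ.memLp_of_smirnov hp hS i) (hΨ.memLp_of_smirnov hp hS i)
  have h0 := integral_average_mul_sub_eq_zero hpq hI hw (Φ := fun i x => Φ i x - Ψ i x) hq
    hΦ.memLp hΨ.memLp fun i => (hΦ.marginal_eq i).trans (hΨ.marginal_eq i).symm
  have havg : MemLp (average fun i x => Φ i x - Ψ i x) (ENNReal.ofReal (p / (p - 1)))
      (weightMeasure I w) := (memLp_finsetSum _ fun i _ => hq i).const_mul _
  have hint : Integrable (fun ξ => average (fun i x => Φ i x - Ψ i x) ξ *
      (signedPower p (average Φ) ξ - signedPower p (average Ψ) ξ)) (weightMeasure I w) :=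
    havg.integrable_mul (MemLp.sub hΦ.memLp hΨ.memLp)
  simp_rw [average_sub] at h0 hint
  have hz := (integral_eq_zero_iff_of_nonneg
    (fun ξ => sub_mul_signedPower_sub_nonneg hp (average Φ ξ) (average Ψ ξ)) hint).1 h0
  rw [EventuallyEq, ae_weightMeasure hw hI] at hz
  filter_upwards [hz] with ξ hξ
  by_contra hne
  exact (sub_mul_signedPower_sub_pos hp hne).ne' hξ

theorem volume_restrict_factor_ne_zero (hw : IsPositiveDensity I w) (i : Fin (d + 1)) :
    volume.restrict (I i) ≠ 0 ∧ volume.restrict (box fun j => I (i.succAbove j)) ≠ 0 := by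
  have h1 := hw.integral_eq_one
  rw [integral_box I i] at h1
  constructor <;> intro h <;> simp [h] at h1

/-- If `∑ δ_j(ξ_j) = 0` almost everywhere on a box, then each `δ_i` is almost everywhere
constant. -/
theorem ae_const_of_sum_ae_eq_zero (hw : IsPositiveDensity I w) {δ : Fin (d + 1) → ℝ → ℝ}
    (h : ∀ᵐ ξ ∂volume.restrict (box I), ∑ j, δ j (ξ j) = 0) (i : Fin (d + 1)) :
    ∃ c, ∀ᵐ x ∂volume.restrict (I i), δ i x = c := by
  have h1 := Measure.ae_ae_of_ae_prod
    (Measure.measurePreserving_swap.quasiMeasurePreserving.ae ((ae_box_iff I i).1 h))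
  have : (ae (volume.restrict (box fun j => I (i.succAbove j)))).NeBot :=
    ae_neBot.2 (volume_restrict_factor_ne_zero hw i).2
  obtain ⟨y, hy⟩ := h1.exists
  refine ⟨-∑ j, δ (i.succAbove j) (y j), ?_⟩
  filter_upwards [hy] with x hx
  rw [Fin.sum_univ_succAbove _ i] at hx
  simp only [Prod.swap, Fin.insertNth_apply_same, Fin.insertNth_apply_succAbove] at hx
  linarith

theorem IsSolution.ae_unique {γ Φ Ψ : Fin (d + 1) → ℝ → ℝ}
    (hp : 1 < p) (hI : ∀ i, MeasurableSet (I i)) (hw : IsPositiveDensity I w)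
    (hS : Smirnov (p / (p - 1)) I w) (hΦ : IsSolution p I w γ Φ) (hΨ : IsSolution p I w γ Ψ)
    (i : Fin (d + 1)) : Φ i =ᵐ[volume.restrict (I i)] Ψ i := by
  have hsum : ∀ᵐ ξ ∂volume.restrict (box I), ∑ j, (Φ j (ξ j) - Ψ j (ξ j)) = 0 := by
    filter_upwards [hΦ.average_ae_eq hp hI hw hS hΨ] with ξ hξ
    rw [← sub_eq_zero, ← average_sub, average] at hξ
    exact (mul_eq_zero.1 hξ).resolve_left (by positivity)
  have hint : ∀ {Θ : Fin (d + 1) → ℝ → ℝ}, IsSolution p I w γ Θ → ∀ i,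
      Integrable (fun x => Θ i x * marginal I w i x) (volume.restrict (I i)) := by
    intro Θ hΘ i
    have h := hΘ.memLp_one i
    rw [MemWeightedLp, ENNReal.ofReal_one, memLp_one_iff_integrable] at h
    exact integrable_mul_marginal ((integrable_weightMeasure_iff hw hI).1 h)
  have hne : ∀ j, j ≠ 0 → ∀ᵐ x ∂volume.restrict (I j), Φ j x - Ψ j x = 0 := by
    intro j hj
    obtain ⟨c, hc⟩ := ae_const_of_sum_ae_eq_zero hw (δ := fun j x => Φ j x - Ψ j x) hsum j
    have h1 : ∫ x in I j, (Φ j x - Ψ j x) * marginal I w j x = 0 := by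
      simp_rw [sub_mul]
      rw [integral_sub (hint hΦ j) (hint hΨ j), hΦ.centred j hj, hΨ.centred j hj, sub_zero]
    have h2 : ∫ x in I j, (Φ j x - Ψ j x) * marginal I w j x = c := by
      have : (fun x => (Φ j x - Ψ j x) * marginal I w j x) =ᵐ[volume.restrict (I j)]
          fun x => c * marginal I w j x := by
        filter_upwards [hc] with x hx
        rw [hx]
      rw [integral_congr_ae this, integral_const_mul, integral_marginal hw.integrableOn,
        hw.integral_eq_one, mul_one]
    rw [h2] at h1
    simpa [h1] using hc
  rcases eq_or_ne i 0 with rfl | hi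
  · have hall : ∀ᵐ ξ ∂volume.restrict (box I), Φ 0 (ξ 0) - Ψ 0 (ξ 0) = 0 := by
      filter_upwards [hsum, ae_all_iff.2 fun j : Fin d =>
        ae_comp_eval (hne j.succ (Fin.succ_ne_zero j))] with ξ h1 h2
      rw [Fin.sum_univ_succ, Finset.sum_eq_zero fun j _ => h2 j, add_zero] at h1
      exact h1
    have h1 := Measure.ae_ae_of_ae_prod
      (Measure.measurePreserving_swap.quasiMeasurePreserving.ae ((ae_box_iff I 0).1 hall))
    have : (ae (volume.restrict (box fun j => I ((0 : Fin (d + 1)).succAbove j)))).NeBot :=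
      ae_neBot.2 (volume_restrict_factor_ne_zero hw 0).2
    obtain ⟨y, hy⟩ := h1.exists
    filter_upwards [hy] with x hx
    exact sub_eq_zero.1 (by simpa using hx)
  · exact (hne i hi).mono fun x hx => sub_eq_zero.1 hx

theorem IsSolution.bound_and_equality {g : (Fin (d + 1) → ℝ) → ℝ} {Φ : Fin (d + 1) → ℝ → ℝ}
    (hp : 1 < p) (hI : ∀ i, MeasurableSet (I i)) (hw : IsPositiveDensity I w)
    (hS : Smirnov (p / (p - 1)) I w) (hg : MemWeightedLp p I w g)
    (hΦ : IsSolution p I w (weightedMarginal I w g) Φ) :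
    ∫ ξ in box I, |average Φ ξ| ^ (p / (p - 1)) * w ξ ≤ ∫ ξ in box I, |g ξ| ^ p * w ξ ∧
    (∫ ξ in box I, |g ξ| ^ p * w ξ = ∫ ξ in box I, |average Φ ξ| ^ (p / (p - 1)) * w ξ ↔
      g =ᵐ[volume.restrict (box I)] signedPower p (average Φ)) := by
  obtain ⟨hint, hval⟩ := hΦ.integral_excess hp hI hw hS hg
  have hFd := dualityMap_signedPower_average hp Φ
  have hpow : ∀ ξ, |signedPower p (average Φ) ξ| ^ p = |average Φ ξ| ^ (p / (p - 1)) :=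
    fun ξ => abs_signedPower_rpow hp _
  have hnonneg : ∀ ξ, 0 ≤ |g ξ| ^ p - (|signedPower p (average Φ) ξ| ^ p
      + p * average Φ ξ * (g ξ - signedPower p (average Φ) ξ)) := by
    intro ξ
    have := tangent_le_abs_rpow hp (signedPower p (average Φ) ξ) (g ξ)
    rw [hFd] at this
    linarith
  have hle : 0 ≤ ∫ ξ, |g ξ| ^ p ∂weightMeasure I w -
      ∫ ξ, |signedPower p (average Φ) ξ| ^ p ∂weightMeasure I w := by
    rw [← hval]
    exact integral_nonneg hnonneg
  have e1 := integral_weightMeasure hw hI (fun ξ => |g ξ| ^ p)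
  have e2 := integral_weightMeasure hw hI (fun ξ => |signedPower p (average Φ) ξ| ^ p)
  rw [e1, e2] at hle hval
  simp_rw [hpow] at hle
  refine ⟨by linarith, fun heq => ?_, fun hae => ?_⟩
  · have hz := (integral_eq_zero_iff_of_nonneg hnonneg hint).1 (by
      rw [hval]
      simp_rw [hpow]
      linarith)
    rw [EventuallyEq, ae_weightMeasure hw hI] at hz
    filter_upwards [hz] with ξ hξ
    by_contra hne
    have := tangent_lt_abs_rpow hp (Ne.symm hne)
    rw [hFd] at this
    simp only [Pi.zero_apply] at hξ
    linarith
  · refine integral_congr_ae ?_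
    filter_upwards [hae] with ξ hξ
    rw [hξ, hpow]

end Solution

end WeightedMarginals

end

theorem theorem1 {d : ℕ} (p : ℝ) (hp : 1 < p)
    (I : Fin (d + 1) → Set ℝ) (hI : ∀ i, WeightedMarginals.IsAdmissibleInterval (I i))
    (w : (Fin (d + 1) → ℝ) → ℝ) (hw : WeightedMarginals.IsPositiveDensity I w)
    (hratio : ∀ i, WeightedMarginals.MemWeightedLp p I w
      (WeightedMarginals.likelihoodRatio I w i))
    (g : (Fin (d + 1) → ℝ) → ℝ) (hg : WeightedMarginals.MemWeightedLp p I w g)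
    (hgi : ∀ i, WeightedMarginals.MemWeightedLp p I w
      (fun ξ => WeightedMarginals.weightedMarginal I w g i (ξ i))) :
    -- existence of a solution that bounds every function with the same marginals as `g`
    (∃ Φ : Fin (d + 1) → ℝ → ℝ,
      WeightedMarginals.IsSolution p I w (WeightedMarginals.weightedMarginal I w g) Φ ∧
      ∀ f : (Fin (d + 1) → ℝ) → ℝ, WeightedMarginals.MemWeightedLp p I w f →
        (∀ i, WeightedMarginals.weightedMarginal I w f i
          =ᵐ[volume.restrict (I i)] WeightedMarginals.weightedMarginal I w g i) →
        ∫ ξ in WeightedMarginals.box I, |f ξ| ^ p * w ξ ≥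
          ∫ ξ in WeightedMarginals.box I,
            |WeightedMarginals.average Φ ξ| ^ (p / (p - 1)) * w ξ) ∧
    -- under the Smirnov property: uniqueness, the bound, and the case of equality
    (WeightedMarginals.Smirnov (p / (p - 1)) I w →
      (∀ Φ Ψ : Fin (d + 1) → ℝ → ℝ,
        WeightedMarginals.IsSolution p I w (WeightedMarginals.weightedMarginal I w g) Φ →
        WeightedMarginals.IsSolution p I w (WeightedMarginals.weightedMarginal I w g) Ψ →
        ∀ i, Φ i =ᵐ[volume.restrict (I i)] Ψ i) ∧
      (∀ Φ : Fin (d + 1) → ℝ → ℝ,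
        WeightedMarginals.IsSolution p I w (WeightedMarginals.weightedMarginal I w g) Φ →
        ∫ ξ in WeightedMarginals.box I, |g ξ| ^ p * w ξ ≥
          ∫ ξ in WeightedMarginals.box I,
            |WeightedMarginals.average Φ ξ| ^ (p / (p - 1)) * w ξ ∧
        (∫ ξ in WeightedMarginals.box I, |g ξ| ^ p * w ξ =
            ∫ ξ in WeightedMarginals.box I,
              |WeightedMarginals.average Φ ξ| ^ (p / (p - 1)) * w ξ ↔
          g =ᵐ[volume.restrict (WeightedMarginals.box I)]
            WeightedMarginals.signedPower p (WeightedMarginals.average Φ)))) := by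
  have hIm := fun i => (hI i).measurableSet
  refine ⟨WeightedMarginals.exists_isSolution_le hp hIm hw hratio hg, fun hS =>
    ⟨fun Φ Ψ hΦ hΨ => hΦ.ae_unique hp hIm hw hS hΨ,
      fun Φ hΦ => hΦ.bound_and_equality hp hIm hw hS hg⟩⟩
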